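/- Let $\mathbb T^3=(\mathbb R/2\pi\mathbb Z)^3$, $\langle n\rangle=(1+|n|^2)^{1/2}$, $\langle t\rangle=(1+t^2)^{1/2}$. For $s\in\mathbb R$ let $H^s(\mathbb T^3)$ be the space of real-valued distributions $f=\sum_{n\in\mathbb Z^3}\hat f(n)e^{in\cdot x}$ with $\|f\|_{H^s}^2=\sum_n\langle n\rangle^{2s}|\hat f(n)|^2<\infty$, and let $\mathcal H^s=H^s\times H^{s-1}$ with $\|(u_0,u_1)\|_{\mathcal H^s}=\|u_0\|_{H^s}+\|u_1\|_{H^{s-1}}$. The free evolution of the wave equation is $$S(t)(v_0,v_1)=\sum_{n\in\mathbb Z^3}\cos(t|n|)\hat v_0(n)e^{in\cdot x}+t\,\hat v_1(0)+\sum_{n\ne0}\frac{\sin(t|n|)}{|n|}\hat v_1(n)e^{in\cdot x}.$$ Let $s\in(0,1)$ and let $(u_0,u_1)\in\mathcal H^s$ be given by real Fourier series $u_j=a_j+\sum_{n\in\mathbb Z^3\setminus\{0\}}(b_{n,j}\cos(n\cdot x)+c_{n,j}\sin(n\cdot x))$, $j=0,1$, in which the terms of index $n$ and $-n$ do not cancel,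 that is, $b_{n,j}b_{-n,j}\ge0$ and $c_{n,j}c_{-n,j}\le0$ (for instance $b_{n,j}=\operatorname{Re}\hat u_j(n)$, $c_{n,j}=-\operatorname{Im}\hat u_j(n)$, or a series with only one of $n,-n$ for each $n\neq 0$). Let $\alpha_j,\beta_{n,j},\gamma_{n,j}$ ($n\in\mathbb Z^3\setminus\{0\}$, $j=0,1$) be independent real random variables on a probability space $(\Omega,\mathbb P)$ with a common law $\theta$ such that, for some $c_0>0$, $\int e^{\gamma x}\,d\theta(x)\le e^{c_0\gamma^2}$ for all $\gamma\in\mathbb R$, and put $$u_j^\omega=\alpha_j(\omega)a_j+\sum_{n\ne0}\bigl(\beta_{n,j}(\omega)b_{n,j}\cos(n\cdot x)+\gamma_{n,j}(\omega)c_{n,j}\sin(n\cdot x)\bigr).$$ Then almost surely $(u_0^\omega,u_1^\omega)\in\mathcal H^s$, and $\omega\mapsto(u_0^\omega,u_1^\omega)$ is a measurable map to $\mathcal H^s$ up to a null set; let $\mu$ be its law, a Borel probability measure on $\mathcal H^s$. **Theorem.** Let $s\in(0,1)$, $\sigma\in(0,s]$, $2\le p_1<\infty$, $2\le p_2\le\infty$,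 $\delta>1+\frac1{p_1}$ and $c_0>0$. There are positive constants $C,C',c'$, depending only on these parameters, such that for all $\Omega,\theta$, all random variables, all $(u_0,u_1)\in\mathcal H^s$ with series as above, and the induced measure $\mu$ (for which all norms below are measurable functions of $t$ and $(v_0,v_1)$): 1. for every real $p\ge2$, $$\Bigl\|\,\|\langle t\rangle^{-\delta}S(t)(v_0,v_1)\|_{L^{p_1}(\mathbb R_t;L^{p_2}(\mathbb T^3))}\Bigr\|_{L^p(\mu)}\le C\sqrt p\,\|(u_0,u_1)\|_{\mathcal H^\sigma};$$ 2. for all $T>0$, $r_1\in[1,\infty)$ and $r_2\in[2,\infty]$, $\|S(t)(v_0,v_1)\|_{L^{r_1}([0,T];L^{r_2}(\mathbb T^3))}<\infty$ for $\mu$-almost every $(v_0,v_1)$; 3. for every $\lambda>0$, $$\mu\Bigl((v_0,v_1)\in\mathcal H^s:\ \|\langle t\rangle^{-\delta}S(t)(v_0,v_1)\|_{L^{p_1}(\mathbb R_t;L^{p_2}(\mathbb T^3))}>\lambda\Bigr)\le C'\exp\Bigl(-\frac{c'\lambda^2}{\|(u_0,u_1)\|_{\mathcal H^\sigma}^2}\Bigr),$$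 where the right-hand side is read as $0$ if $(u_0,u_1)=0$. -/

import Mathlib

open MeasureTheory ProbabilityTheory
open scoped ENNReal

noncomputable section

namespace ProbStrichartz

/-- Frequencies `n ∈ ℤ³`. -/
abbrev Freq : Type := Fin 3 → ℤ

/-- Nonzero frequencies `ℤ³ \ {0}`. -/
abbrev FreqStar : Type := {n : Freq // n ≠ 0}

/-- The frequency `-n` for `n ≠ 0`. -/
def FreqStar.opp (n : FreqStar) : FreqStar := ⟨-n.1, neg_ne_zero.mpr n.2⟩

/-- The Euclidean length `|n|`. -/
def len (n : Freq) : ℝ := Real.sqrt (∑ i, (n i : ℝ) ^ 2)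

/-- The bracket `⟨n⟩ = (1 + |n|²)^{1/2}`. -/
def bracket (n : Freq) : ℝ := Real.sqrt (1 + ∑ i, (n i : ℝ) ^ 2)

/-- The bracket `⟨t⟩ = (1 + t²)^{1/2}` of a time `t`. -/
def timeBracket (t : ℝ) : ℝ := Real.sqrt (1 + t ^ 2)

theorem bracket_pos (n : Freq) : 0 < bracket n :=
  Real.sqrt_pos.mpr (add_pos_of_pos_of_nonneg one_pos (Finset.sum_nonneg fun _ _ => sq_nonneg _))

/-! ### Sobolev spaces on the torus

A distribution on `𝕋³ = (ℝ/2πℤ)³` is given by its Fourier coefficients `f̂ : ℤ³ → ℂ`,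
`f = ∑ f̂(n) e^{i n·x}`; it is real valued exactly when `f̂(-n)` is the conjugate of `f̂(n)`. -/

/-- Finiteness of `∑ ⟨n⟩^{2s} |f̂(n)|²`. -/
def HasSobolevRegularity (s : ℝ) (f : Freq → ℂ) : Prop :=
  Summable fun n => bracket n ^ (2 * s) * ‖f n‖ ^ 2

/-- The `H^s` norm `(∑ ⟨n⟩^{2s} |f̂(n)|²)^{1/2}`. -/
def sobolevNorm (s : ℝ) (f : Freq → ℂ) : ℝ :=
  Real.sqrt (∑' n, bracket n ^ (2 * s) * ‖f n‖ ^ 2)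

theorem weight_norm_sq (s : ℝ) (f : Freq → ℂ) (n : Freq) :
    ‖bracket n ^ s • f n‖ ^ (2 : ℝ≥0∞).toReal = bracket n ^ (2 * s) * ‖f n‖ ^ 2 := by
  have h := (bracket_pos n).le
  rw [ENNReal.toReal_ofNat, Real.rpow_two, norm_smul, mul_pow, Real.norm_of_nonneg
    (Real.rpow_nonneg h s), mul_comm 2 s, Real.rpow_mul h, Real.rpow_two]

theorem hasSobolevRegularity_iff (s : ℝ) (f : Freq → ℂ) :
    HasSobolevRegularity s f ↔ Memℓp (fun n => bracket n ^ s • f n) 2 := by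
  rw [memℓp_gen_iff (by norm_num)]
  simp only [weight_norm_sq, HasSobolevRegularity]

/-- The Sobolev space `H^s(𝕋³)` of real valued distributions, as a set of Fourier coefficients. -/
def sobolevSubmodule (s : ℝ) : Submodule ℝ (Freq → ℂ) where
  carrier := {f | (∀ n, f (-n) = star (f n)) ∧ HasSobolevRegularity s f}
  zero_mem' := by
    refine ⟨fun n => by simp, ?_⟩
    simp [HasSobolevRegularity, summable_zero]
  add_mem' := by
    rintro f g ⟨hf, hf'⟩ ⟨hg, hg'⟩
    refine ⟨fun n => by simp [hf n, hg n], ?_⟩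
    rw [hasSobolevRegularity_iff] at *
    convert hf'.add hg' using 1
    ext n
    simp
  smul_mem' := by
    rintro r f ⟨hf, hf'⟩
    refine ⟨fun n => by simp [hf n], ?_⟩
    rw [hasSobolevRegularity_iff] at *
    convert hf'.const_smul r using 1
    ext n
    simp only [Pi.smul_apply]
    rw [smul_comm]

/-- The Sobolev space `H^s(𝕋³)` as a type, which gets its own norm below. -/
def HSob (s : ℝ) : Type := sobolevSubmodule s

instance (s : ℝ) : AddCommGroup (HSob s) := inferInstanceAs (AddCommGroup (sobolevSubmodule s))

instance (s : ℝ) : Module ℝ (HSob s) := inferInstanceAs (Module ℝ (sobolevSubmodule s))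

/-- The weighted coefficients `⟨n⟩^s f̂(n)`, an element of `ℓ²(ℤ³)`. -/
def HSob.toLp (s : ℝ) : HSob s →ₗ[ℝ] lp (fun _ : Freq => ℂ) 2 where
  toFun f := ⟨fun n => bracket n ^ s • f.1 n, (hasSobolevRegularity_iff s f.1).mp f.2.2⟩
  map_add' f g := Subtype.ext (funext fun n => smul_add (bracket n ^ s) (f.1 n) (g.1 n))
  map_smul' r f := Subtype.ext (funext fun n => smul_comm (bracket n ^ s) r (f.1 n))

theorem HSob.toLp_injective (s : ℝ) : Function.Injective (HSob.toLp s) := by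
  intro f g h
  refine Subtype.ext (funext fun n => ?_)
  have h1 : bracket n ^ s • f.1 n = bracket n ^ s • g.1 n :=
    congrFun (congrArg Subtype.val h) n
  exact smul_right_injective ℂ (Real.rpow_pos_of_pos (bracket_pos n) s).ne' h1

instance (s : ℝ) : NormedAddCommGroup (HSob s) :=
  NormedAddCommGroup.induced (HSob s) (lp (fun _ : Freq => ℂ) 2) (HSob.toLp s)
    (HSob.toLp_injective s)

instance (s : ℝ) : NormedSpace ℝ (HSob s) :=
  NormedSpace.induced ℝ (HSob s) (lp (fun _ : Freq => ℂ) 2) (HSob.toLp s)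

/-- The norm of the space `H^s` is the Sobolev norm. -/
theorem HSob.norm_eq (s : ℝ) (f : HSob s) : ‖f‖ = sobolevNorm s f.1 := by
  change ‖HSob.toLp s f‖ = _
  rw [lp.norm_eq_tsum_rpow (by norm_num), sobolevNorm, Real.sqrt_eq_rpow]
  rw [ENNReal.toReal_ofNat]
  congr 1
  exact tsum_congr fun n => by
    rw [← weight_norm_sq s f.1 n, ENNReal.toReal_ofNat]
    rfl

instance (s : ℝ) : MeasurableSpace (HSob s) := borel (HSob s)

instance (s : ℝ) : BorelSpace (HSob s) := ⟨rfl⟩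

/-- The space `𝓗^s = H^s × H^{s-1}` of initial data. -/
abbrev Data (s : ℝ) : Type := HSob s × HSob (s - 1)

/-- The norm `‖u₀‖_{H^σ} + ‖u₁‖_{H^{σ-1}}` of a pair, also used for `σ ≠ s`. -/
def dataNorm (σ : ℝ) {s : ℝ} (u : Data s) : ℝ :=
  sobolevNorm σ u.1.1 + sobolevNorm (σ - 1) u.2.1

/-! ### Lebesgue norms and the free evolution -/

/-- Lebesgue measure `dx` (total mass `(2π)³`) on the torus `(ℝ/2πℤ)³`, which is parametrized by
the unit torus through `x = 2πy`, so that `e^{i n·x}` is Mathlib's character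
`UnitAddTorus.mFourier n` and `(2π)⁻³ ∫ g e^{-i n·x} dx` is `UnitAddTorus.mFourierCoeff g n`. -/
def torusMeasure : Measure (UnitAddTorus (Fin 3)) :=
  ENNReal.ofReal ((2 * Real.pi) ^ 3) • Measure.pi fun _ => AddCircle.haarAddCircle

/-- The norm in `L^q(𝕋³)` of the distribution with Fourier coefficients `f`: the `L^q` norm of the
integrable function with these Fourier coefficients (unique almost everywhere), and `∞` if there
is no such function. -/
def torusLpNorm (q : ℝ≥0∞) (f : Freq → ℂ) : ℝ≥0∞ :=
  ⨅ (g : UnitAddTorus (Fin 3) → ℂ) (_ : Integrable g torusMeasure)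
    (_ : ∀ n, UnitAddTorus.mFourierCoeff g n = f n), eLpNorm g q torusMeasure

/-- The free evolution `S(t)(v₀, v₁) = cos(t√(-Δ)) v₀ + (sin(t√(-Δ))/√(-Δ)) v₁`, through its
Fourier coefficients. -/
def freeEvolution (t : ℝ) {s : ℝ} (v : Data s) (n : Freq) : ℂ :=
  (Real.cos (t * len n) : ℂ) * v.1.1 n +
    (if n = 0 then (t : ℂ) else ((Real.sin (t * len n) / len n : ℝ) : ℂ)) * v.2.1 n

/-- The norm of `t ↦ F(t)` in `L^p(ν(dt); L^q(𝕋³))`. -/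
def mixedNorm (ν : Measure ℝ) (p q : ℝ≥0∞) (F : ℝ → Freq → ℂ) : ℝ≥0∞ :=
  eLpNorm (fun t => torusLpNorm q (F t)) p ν

/-- The norm of `⟨t⟩^{-δ} S(t)(v₀, v₁)` in `L^{p}(ℝ_t; L^{q}(𝕋³))`. -/
def weightedNorm (δ : ℝ) (p q : ℝ≥0∞) {s : ℝ} (v : Data s) : ℝ≥0∞ :=
  mixedNorm volume p q fun t n => ((timeBracket t ^ (-δ) : ℝ) : ℂ) * freeEvolution t v n

/-! ### Randomization -/

/-- The modes of a real Fourier series: `1`, `cos(n·x)` and `sin(n·x)` with `n ∈ ℤ³ \ {0}`. -/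
inductive Mode : Type
  | const : Mode
  | cos : FreqStar → Mode
  | sin : FreqStar → Mode

/-- The complex Fourier coefficients of
`a + ∑_{n ≠ 0} (b_n cos(n·x) + c_n sin(n·x))`, where `a = A const`, `b_n = A (cos n)` and
`c_n = A (sin n)`. -/
def fourierOfTrig (A : Mode → ℝ) (k : Freq) : ℂ :=
  if h : k = 0 then (A Mode.const : ℂ)
  else
    let n : FreqStar := ⟨k, h⟩
    ((A (Mode.cos n) + A (Mode.cos n.opp) : ℝ) : ℂ) / 2 +
      ((A (Mode.sin n) - A (Mode.sin n.opp) : ℝ) : ℂ) / (2 * Complex.I)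

theorem fourierOfTrig_neg (A : Mode → ℝ) (k : Freq) :
    fourierOfTrig A (-k) = star (fourierOfTrig A k) := by
  by_cases h : k = 0
  · subst h
    simp [fourierOfTrig]
  · have h' : -k ≠ 0 := neg_ne_zero.mpr h
    simp only [fourierOfTrig, h, h', dif_neg, not_false_eq_true, FreqStar.opp, neg_neg]
    apply Complex.ext <;> simp [Complex.div_re, Complex.div_im, Complex.normSq] <;> ring

/-- `A` are the coefficients of a real Fourier series of the distribution with complex Fourier
coefficients `f`. Since `cos(n·x)` and `cos(-n·x)` coincide and `sin(n·x)`, `sin(-n·x)` are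
opposite, such a series is not unique; the sign conditions say that the terms of index `n` and
`-n` do not cancel. They hold for the series with `b_n = Re f̂(n)`, `c_n = -Im f̂(n)` for all
`n ≠ 0`, and for every series that uses only one of `n`, `-n` for each `n ≠ 0`. -/
def IsTrigSeriesOf (A : Mode → ℝ) (f : Freq → ℂ) : Prop :=
  (∀ n, f n = fourierOfTrig A n) ∧
  (∀ n, 0 ≤ A (Mode.cos n) * A (Mode.cos n.opp)) ∧
  (∀ n, A (Mode.sin n) * A (Mode.sin n.opp) ≤ 0)

open Classical in
/-- The sum of a real Fourier series as an element of `H^s`, and `0` if it is not in `H^s`. -/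
def trigSum (s : ℝ) (A : Mode → ℝ) : HSob s :=
  if h : HasSobolevRegularity s (fourierOfTrig A) then
    ⟨fourierOfTrig A, fourierOfTrig_neg A, h⟩
  else 0

/-- The randomized coefficients: each coefficient of the two series is multiplied by its own
random variable. -/
def randCoeff {Ω : Type*} (A : Fin 2 → Mode → ℝ) (ξ : Fin 2 × Mode → Ω → ℝ) (ω : Ω) (j : Fin 2)
    (m : Mode) : ℝ :=
  ξ (j, m) ω * A j m

/-- The randomized pair `(u₀^ω, u₁^ω)`. -/
def randData {Ω : Type*} (s : ℝ) (A : Fin 2 → Mode → ℝ) (ξ : Fin 2 × Mode → Ω → ℝ) (ω : Ω) :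
    Data s :=
  (trigSum s (randCoeff A ξ ω 0), trigSum (s - 1) (randCoeff A ξ ω 1))

/-- The measure on `𝓗^s` induced by the randomization, the law of `(u₀^ω, u₁^ω)`. -/
def inducedMeasure {Ω : Type*} [MeasurableSpace Ω] (P : Measure Ω) (s : ℝ) (A : Fin 2 → Mode → ℝ)
    (ξ : Fin 2 × Mode → Ω → ℝ) : Measure (Data s) :=
  P.map (randData s A ξ)

/-- The bound `∫ e^{γx} dθ(x) ≤ e^{cγ²}` for all real `γ`. -/
def SubGaussianLaw (c : ℝ) (θ : Measure ℝ) : Prop :=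
  ∀ γ : ℝ, Integrable (fun x => Real.exp (γ * x)) θ ∧
    ∫ x, Real.exp (γ * x) ∂θ ≤ Real.exp (c * γ ^ 2)

end ProbStrichartz

end

/-! Everything reduces to one estimate at a fixed time: for finite `p ≥ 4/σ`, the `L^p(Ω; L^∞(𝕋³))`
norm of the randomized evolution is at most a constant times `√p ⟨t⟩ ‖(u₀,u₁)‖_{𝓗^σ}`. The torus has
finite mass, so `L^∞` controls every `L^q` and the case `p₂ = ∞` needs no separate treatment.

The fixed-time estimate combines two facts. Since `σ · (4/σ) = 4 > 3`, there is an embedding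
`W^{σ,4/σ} ⊆ L^∞` (`eLpNorm_top_trigPoly_le`). At a fixed point `(t, x)` the lifted series is a sum
of independent sub-Gaussian variables, and its `p`-th moment is at most `√p` times the `ℓ²` norm of
its coefficients (`eLpNorm_sum_mul_le`). Since `p ≥ 4/σ` and the torus carries a probability
measure, Tonelli exchanges the moments with the integral in `x`. Khintchine sees only the size of
the coefficients, so the derivative of order `σ` may be replaced by any multiplier of size at most a
constant times `⟨n⟩^σ`. The one chosen inverts a dyadic sum of Fejér kernels; the embedding is then
elementary and no multiplier theorem on `L^q` is used.

The coefficients at `n` and `-n` share random variables. They are split into four families, each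
made of distinct variables, and the absence of cancellation bounds each family by the coefficients
of the data (`sq_mode_le`). The argument is run on trigonometric polynomials; lower semicontinuity
of the norms under `L²` convergence and Fatou's lemma pass to the limit
(`lintegral_torusLpNorm_rpow_le`).

In time, the growth `⟨t⟩` comes from the zero mode of the velocity, and `⟨t⟩^{1-δ}` lies in `L^{p₁}`
because `(δ-1)p₁ > 1`. Jensen and Tonelli turn fixed-time moments into moments of the mixed norm
(`lintegral_eLpNorm_rpow_le`); small `p` is reached by monotonicity of moments. Markov's inequality
with an optimized `p` gives the Gaussian tail. -/

noncomputable section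

namespace ProbStrichartz

open Filter Topology UnitAddTorus
open scoped NNReal

/-! ### Square-summable Fourier series on the torus -/

/-- The normalized Haar measure on the torus. -/
def haarTorus : Measure (UnitAddTorus (Fin 3)) := Measure.pi fun _ => AddCircle.haarAddCircle

instance : IsProbabilityMeasure haarTorus :=
  inferInstanceAs (IsProbabilityMeasure
    (Measure.pi fun _ : Fin 3 => (AddCircle.haarAddCircle : Measure UnitAddCircle)))

/-- The total mass `(2π)³` of the torus. -/
def torusMass : ℝ≥0∞ := ENNReal.ofReal ((2 * Real.pi) ^ 3)

theorem torusMass_ne_zero : torusMass ≠ 0 := by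
  rw [torusMass, ne_eq, ENNReal.ofReal_eq_zero, not_le]
  have := Real.pi_pos
  positivity

theorem torusMass_ne_top : torusMass ≠ ∞ := ENNReal.ofReal_ne_top

theorem torusMeasure_eq : torusMeasure = torusMass • haarTorus := rfl

instance : IsFiniteMeasure torusMeasure :=
  ⟨by simp [torusMeasure_eq, torusMass_ne_top.lt_top]⟩

theorem torusMeasure_univ : torusMeasure Set.univ = torusMass := by
  simp [torusMeasure_eq]

theorem ae_torusMeasure : ae torusMeasure = ae haarTorus := by
  rw [torusMeasure_eq, Measure.ae_ennreal_smul_measure_eq torusMass_ne_zero]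

theorem integrable_torusMeasure_iff {g : UnitAddTorus (Fin 3) → ℂ} :
    Integrable g torusMeasure ↔ Integrable g haarTorus := by
  rw [torusMeasure_eq, integrable_smul_measure torusMass_ne_zero torusMass_ne_top]

theorem memLp_torusMeasure_iff {g : UnitAddTorus (Fin 3) → ℂ} {q : ℝ≥0∞} :
    MemLp g q torusMeasure ↔ MemLp g q haarTorus := by
  rw [torusMeasure_eq]
  refine ⟨fun h => ?_, fun h => h.smul_measure torusMass_ne_top⟩
  have := h.smul_measure (c := torusMass⁻¹) (ENNReal.inv_ne_top.mpr torusMass_ne_zero)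
  rwa [smul_smul, ENNReal.inv_mul_cancel torusMass_ne_zero torusMass_ne_top, one_smul] at this

/-- The Hilbert basis of exponentials. -/
def expBasis : HilbertBasis Freq ℂ (Lp ℂ 2 haarTorus) := mFourierBasis

theorem expBasis_repr (g : Lp ℂ 2 haarTorus) (n : Freq) :
    expBasis.repr g n = mFourierCoeff g n := mFourierBasis_repr g n

theorem coeFn_expBasis (n : Freq) : expBasis n =ᵐ[haarTorus] mFourier n := by
  have h : expBasis n = mFourierLp 2 n := congrFun coe_mFourierBasis n
  rw [h]
  exact coeFn_mFourierLp 2 n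

/-- The `L²` function with given square-summable Fourier coefficients. -/
def synth (f : lp (fun _ : Freq => ℂ) 2) : Lp ℂ 2 haarTorus := expBasis.repr.symm f

theorem mFourierCoeff_synth (f : lp (fun _ : Freq => ℂ) 2) (n : Freq) :
    mFourierCoeff (synth f) n = f n := by
  rw [← expBasis_repr, synth, LinearIsometryEquiv.apply_symm_apply]

theorem hasSum_synth (f : lp (fun _ : Freq => ℂ) 2) :
    HasSum (fun n => f n • expBasis n) (synth f) := expBasis.hasSum_repr_symm f

theorem ae_eq_synth {f : lp (fun _ : Freq => ℂ) 2} {g : UnitAddTorus (Fin 3) → ℂ}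
    (hg : MemLp g 2 haarTorus) (hgf : ∀ n, mFourierCoeff g n = f n) :
    g =ᵐ[haarTorus] synth f := by
  have h : hg.toLp g = synth f := by
    rw [synth, LinearIsometryEquiv.eq_symm_apply]
    refine lp.ext (funext fun n => ?_)
    rw [expBasis_repr, ← hgf n]
    exact integral_congr_ae (by
      filter_upwards [hg.coeFn_toLp] with x hx
      rw [hx])
  rw [← h]
  exact hg.coeFn_toLp.symm

/-- A competitor of finite `L^q` norm is in `L²`, since `q ≥ 2` and the measure is finite, and an
`L²` function is determined by its Fourier coefficients. Competitors of infinite norm do not affect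
the infimum. -/
theorem torusLpNorm_eq {q : ℝ≥0∞} (hq : 2 ≤ q) (f : lp (fun _ : Freq => ℂ) 2) :
    torusLpNorm q f = eLpNorm (synth f) q torusMeasure := by
  refine le_antisymm ?_ ?_
  · exact iInf_le_of_le (synth f) (iInf_le_of_le
      (integrable_torusMeasure_iff.mpr ((Lp.memLp (synth f)).integrable one_le_two))
      (iInf_le _ (mFourierCoeff_synth f)))
  · refine le_iInf fun g => le_iInf fun hg => le_iInf fun hgf => ?_
    by_cases htop : eLpNorm g q torusMeasure = ∞
    · simp [htop]
    · have h2 : MemLp g 2 haarTorus := memLp_torusMeasure_iff.mp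
        (MemLp.mono_exponent ⟨hg.1, lt_top_iff_ne_top.mpr htop⟩ hq)
      refine (eLpNorm_congr_ae ?_).le
      have := ae_eq_synth h2 hgf
      rw [Filter.EventuallyEq, ae_torusMeasure]
      exact this.symm

/-- An `L²`-convergent sequence has an almost everywhere convergent subsequence, and Fatou's lemma
bounds the norm of the limit; so the sublevel sets are closed in `L²`. -/
theorem lowerSemicontinuous_eLpNorm (q : ℝ≥0∞) :
    LowerSemicontinuous fun g : Lp ℂ 2 haarTorus => eLpNorm g q torusMeasure := by
  rw [lowerSemicontinuous_iff_isClosed_preimage]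
  intro C
  refine IsSeqClosed.isClosed fun u g hu hug => ?_
  obtain ⟨φ, -, hφ⟩ := (tendstoInMeasure_of_tendsto_Lp hug).exists_seq_tendsto_ae
  refine Lp.eLpNorm_le_of_ae_tendsto (u := atTop) (f := fun k => u (φ k))
    (Eventually.of_forall fun k => hu (φ k)) (fun k => ?_) ?_
  · exact (memLp_torusMeasure_iff.mpr (Lp.memLp (u (φ k)))).1
  · rwa [ae_torusMeasure]

/-- The trigonometric polynomial `∑_{n ∈ F} f(n) e^{i n·x}`. -/
def trigPoly (F : Finset Freq) (f : Freq → ℂ) (x : UnitAddTorus (Fin 3)) : ℂ :=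
  ∑ n ∈ F, f n * mFourier n x

theorem continuous_trigPoly (F : Finset Freq) (f : Freq → ℂ) : Continuous (trigPoly F f) :=
  continuous_finsetSum _ fun n _ => continuous_const.mul (mFourier n).continuous

theorem coeFn_sum_expBasis (F : Finset Freq) (f : Freq → ℂ) :
    (∑ n ∈ F, f n • expBasis n : Lp ℂ 2 haarTorus) =ᵐ[haarTorus] trigPoly F f := by
  have h : ∀ᵐ x ∂haarTorus, ∀ n : Freq, expBasis n x = mFourier n x :=
    ae_all_iff.mpr coeFn_expBasis
  have h' : ∀ᵐ x ∂haarTorus, ∀ n : Freq,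
      (f n • expBasis n : Lp ℂ 2 haarTorus) x = f n * expBasis n x := by
    refine ae_all_iff.mpr fun n => ?_
    filter_upwards [Lp.coeFn_smul (f n) (expBasis n)] with x hx
    rw [hx]; rfl
  filter_upwards [h, h', Lp.coeFn_finsetSum F fun n => f n • expBasis n] with x hx hx' hs
  rw [hs, Finset.sum_apply]
  exact Finset.sum_congr rfl fun n _ => by rw [hx' n, hx n]

/-- The partial sums need to converge only in `L²`; in `L^∞` they may diverge. -/
theorem torusLpNorm_le_liminf {q : ℝ≥0∞} (hq : 2 ≤ q) {f : Freq → ℂ} (hf : Memℓp f 2)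
    {F : ℕ → Finset Freq} (hF : Tendsto F atTop atTop) :
    torusLpNorm q f ≤ liminf (fun N => eLpNorm (trigPoly (F N) f) q torusMeasure) atTop := by
  have h := (hasSum_synth ⟨f, hf⟩).comp hF
  have heq := torusLpNorm_eq hq ⟨f, hf⟩
  refine le_of_forall_lt fun y hy => ?_
  obtain ⟨z, hyz, hz⟩ := exists_between hy
  refine hyz.trans_le (le_liminf_of_le (by isBoundedDefault) ?_)
  have := h.eventually (lowerSemicontinuous_eLpNorm q (synth ⟨f, hf⟩) z (hz.trans_eq heq))
  filter_upwards [this] with N hN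
  refine hN.le.trans_eq (eLpNorm_congr_ae ?_)
  rw [Filter.EventuallyEq, ae_torusMeasure]
  exact coeFn_sum_expBasis (F N) f

/-- The spatial norm depends measurably on parameters if the Fourier coefficients do. -/
theorem measurable_torusLpNorm {Z : Type*} [MeasurableSpace Z] {q : ℝ≥0∞} (hq : 2 ≤ q)
    {f : Z → Freq → ℂ} (hf : ∀ z, Memℓp (f z) 2) (hm : ∀ n, Measurable fun z => f z n) :
    Measurable fun z => torusLpNorm q (f z) := by
  let : MeasurableSpace (Lp ℂ 2 haarTorus) := borel _
  have : BorelSpace (Lp ℂ 2 haarTorus) := ⟨rfl⟩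
  have h1 : Measurable fun z => synth ⟨f z, hf z⟩ := by
    refine measurable_of_tendsto_metrizable' (atTop : Filter (Finset Freq))
      (f := fun F z => ∑ n ∈ F, f z n • expBasis n) (fun F => ?_)
      (tendsto_pi_nhds.mpr fun z => hasSum_synth ⟨f z, hf z⟩)
    have : ∀ a : Freq → ℂ, ∑ n ∈ F, a n • expBasis n =
        (fun b : F → ℂ => ∑ n : F, b n • expBasis n.1) fun n => a n.1 := fun a =>
      (Finset.sum_coe_sort F fun n => a n • expBasis n).symm
    simp_rw [this]
    refine Continuous.measurable (f := fun b : F → ℂ => ∑ n : F, b n • expBasis n.1)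
      (by fun_prop) |>.comp (measurable_pi_lambda _ fun n => hm n.1)
  have h2 := (lowerSemicontinuous_eLpNorm q).measurable.comp h1
  convert h2 using 2 with z
  exact torusLpNorm_eq hq ⟨f z, hf z⟩

theorem mFourierCoeff_const_mul (c : ℂ) (g : UnitAddTorus (Fin 3) → ℂ) (n : Freq) :
    mFourierCoeff (fun x => c * g x) n = c * mFourierCoeff g n := by
  simp only [mFourierCoeff, smul_eq_mul, mul_left_comm _ c]
  exact integral_const_mul _ _

theorem torusLpNorm_const_mul_le (q : ℝ≥0∞) {c : ℂ} (hc : c ≠ 0) (f : Freq → ℂ) :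
    torusLpNorm q (fun n => c * f n) ≤ ‖c‖ₑ * torusLpNorm q f := by
  simp only [torusLpNorm, ENNReal.mul_iInf_of_ne (enorm_ne_zero.mpr hc) enorm_ne_top]
  refine le_iInf fun g => le_iInf fun hg => le_iInf fun hgf => ?_
  refine iInf_le_of_le (fun x => c * g x) (iInf_le_of_le (hg.const_mul c)
    (iInf_le_of_le (fun n => ?_) ?_))
  · rw [mFourierCoeff_const_mul, hgf]
  · exact (eLpNorm_const_smul c g q torusMeasure).le

theorem torusLpNorm_const_mul (q : ℝ≥0∞) {c : ℂ} (hc : c ≠ 0) (f : Freq → ℂ) :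
    torusLpNorm q (fun n => c * f n) = ‖c‖ₑ * torusLpNorm q f := by
  refine le_antisymm (torusLpNorm_const_mul_le q hc f) ?_
  have h := torusLpNorm_const_mul_le q (inv_ne_zero hc) fun n => c * f n
  simp only [inv_mul_cancel_left₀ hc] at h
  calc ‖c‖ₑ * torusLpNorm q f ≤ ‖c‖ₑ * (‖c⁻¹‖ₑ * torusLpNorm q fun n => c * f n) := by gcongr
    _ = torusLpNorm q fun n => c * f n := by
      rw [← mul_assoc, ← enorm_mul, mul_inv_cancel₀ hc, enorm_one, one_mul]

/-- Up to a constant, all norms are bounded by the one of `L^∞`. -/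
theorem torusLpNorm_le_top {q : ℝ≥0∞} (f : Freq → ℂ) :
    torusLpNorm q f ≤ torusMass ^ (1 / q.toReal) * torusLpNorm ∞ f := by
  have hz : torusMass ^ (1 / q.toReal) ≠ 0 := by
    simp [ENNReal.rpow_eq_zero_iff, torusMass_ne_zero, torusMass_ne_top]
  have ht : torusMass ^ (1 / q.toReal) ≠ ∞ :=
    ENNReal.rpow_ne_top_of_nonneg (by positivity) torusMass_ne_top
  simp only [torusLpNorm, ENNReal.mul_iInf_of_ne hz ht]
  refine le_iInf fun g => le_iInf fun hg => le_iInf fun hgf => ?_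
  refine iInf_le_of_le g (iInf_le_of_le hg (iInf_le_of_le hgf ?_))
  have := eLpNorm_le_eLpNorm_mul_rpow_measure_univ (p := q) (q := ∞) le_top hg.1
  rwa [torusMeasure_univ, ENNReal.toReal_top, div_zero, sub_zero, mul_comm] at this

/-! ### A Sobolev embedding for trigonometric polynomials -/

instance : haarTorus.IsAddLeftInvariant :=
  inferInstanceAs (Measure.IsAddLeftInvariant
    (Measure.pi fun _ : Fin 3 => (AddCircle.haarAddCircle : Measure UnitAddCircle)))

theorem integral_mFourier (n : Freq) :
    ∫ x, mFourier n x ∂haarTorus = if n = 0 then 1 else 0 := by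
  have h := orthonormal_iff_ite.mp (orthonormal_mFourier (d := Fin 3)) 0 n
  rw [ContinuousMap.inner_toLp] at h
  simp only [mFourier_zero, ContinuousMap.one_apply, map_one, mul_one, eq_comm (a := (0 : Freq))]
    at h
  exact h

theorem norm_mFourier_apply (n : Freq) (x : UnitAddTorus (Fin 3)) : ‖mFourier n x‖ = 1 := by
  simp only [mFourier, fourier_apply, ContinuousMap.coe_mk, norm_prod, Circle.norm_coe,
      Finset.prod_const_one]

theorem mFourier_apply_add (n : Freq) (x y : UnitAddTorus (Fin 3)) :
    mFourier n (x + y) = mFourier n x * mFourier n y := by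
  simp [mFourier, Finset.prod_mul_distrib, fourier_apply, AddCircle.toCircle_add]

/-- The frequencies with all entries in `[0, 3M]`. -/
def freqBox (M : ℕ) : Finset Freq := Fintype.piFinset fun _ => Finset.Icc (0 : ℤ) (3 * M)

theorem card_freqBox (M : ℕ) : (freqBox M).card = (3 * M + 1) ^ 3 := by
  rw [freqBox, Fintype.card_piFinset_const, Int.card_Icc]
  rfl

theorem card_freqBox_pos (M : ℕ) : (0 : ℝ) < (freqBox M).card := by
  rw [card_freqBox]; positivity

/-- A Fejér kernel on the torus. -/
def fejer (M : ℕ) (x : UnitAddTorus (Fin 3)) : ℝ :=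
  ((freqBox M).card : ℝ)⁻¹ * ‖∑ j ∈ freqBox M, mFourier j x‖ ^ 2

/-- The Fourier coefficients of the Fejér kernel. -/
def fejerCoeff (M : ℕ) (n : Freq) : ℝ :=
  ((freqBox M).card : ℝ)⁻¹ * ((freqBox M).filter fun j => j + n ∈ freqBox M).card

theorem fejer_nonneg (M : ℕ) (x : UnitAddTorus (Fin 3)) : 0 ≤ fejer M x := by
  unfold fejer; positivity

theorem continuous_fejer (M : ℕ) : Continuous (fejer M) := by
  unfold fejer
  fun_prop

theorem fejer_le (M : ℕ) (x : UnitAddTorus (Fin 3)) : fejer M x ≤ (freqBox M).card := by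
  have h : ‖∑ j ∈ freqBox M, mFourier j x‖ ≤ (freqBox M).card := by
    refine (norm_sum_le _ _).trans ?_
    simp [norm_mFourier_apply]
  have hc := card_freqBox_pos M
  rw [fejer, inv_mul_le_iff₀ hc, ← sq]
  gcongr

/-- Expanding the square gives the characters `j + n - k`; the integral keeps exactly the pairs with
`k = j + n`. -/
theorem integral_fejer_mul (M : ℕ) (n : Freq) :
    ∫ x, (fejer M x : ℂ) * mFourier n x ∂haarTorus = fejerCoeff M n := by
  have h : ∀ x, (fejer M x : ℂ) * mFourier n x = ((freqBox M).card : ℂ)⁻¹ *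
      ∑ j ∈ freqBox M, ∑ k ∈ freqBox M, mFourier (j + n - k) x := by
    intro x
    have : ((‖∑ j ∈ freqBox M, mFourier j x‖ ^ 2 : ℝ) : ℂ) =
        (∑ j ∈ freqBox M, mFourier j x) * ∑ k ∈ freqBox M, mFourier (-k) x := by
      simp_rw [mFourier_neg, ← map_sum, Complex.mul_conj, Complex.normSq_eq_norm_sq]
    simp only [fejer, Complex.ofReal_mul, this, Complex.ofReal_inv, Complex.ofReal_natCast]
    rw [mul_assoc, Finset.sum_mul_sum, Finset.sum_mul]
    congr 1
    refine Finset.sum_congr rfl fun j _ => ?_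
    rw [Finset.sum_mul]
    refine Finset.sum_congr rfl fun k _ => ?_
    rw [sub_eq_add_neg, mFourier_add, mFourier_add]
    ring
  have hint : ∀ m : Freq, Integrable (fun x => mFourier m x) haarTorus := fun m =>
    (mFourier m).continuous.integrable_of_hasCompactSupport (HasCompactSupport.of_compactSpace _)
  simp_rw [h]
  rw [integral_const_mul, integral_finsetSum _ fun j _ => integrable_finsetSum _ fun k _ => hint _]
  simp_rw [integral_finsetSum _ fun k _ => hint _, integral_mFourier, sub_eq_zero]
  simp only [Finset.sum_ite_eq, fejerCoeff]
  push_cast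
  rw [Finset.sum_ite, Finset.sum_const_zero, add_zero, Finset.sum_const, nsmul_eq_mul, mul_one]

theorem fejerCoeff_nonneg (M : ℕ) (n : Freq) : 0 ≤ fejerCoeff M n := by
  unfold fejerCoeff; positivity

theorem fejerCoeff_le_one (M : ℕ) (n : Freq) : fejerCoeff M n ≤ 1 := by
  rw [fejerCoeff, inv_mul_le_iff₀ (card_freqBox_pos M), mul_one]
  exact_mod_cast Finset.card_filter_le _ _

theorem fejerCoeff_zero (M : ℕ) : fejerCoeff M 0 = 1 := by
  have := card_freqBox_pos M
  rw [fejerCoeff, Finset.filter_true_of_mem (fun j hj => by simpa using hj),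
    inv_mul_cancel₀ this.ne']

/-- The middle cube `[M, 2M]³` stays inside `[0, 3M]³` when translated by `n`, and `(M+1)³ / (3M+1)³
≥ 1/27`. -/
theorem le_fejerCoeff {M : ℕ} {n : Freq} (hn : ∀ i, |n i| ≤ M) : 1 / 27 ≤ fejerCoeff M n := by
  have hsub : (Fintype.piFinset fun _ : Fin 3 => Finset.Icc (M : ℤ) (2 * M)) ⊆
      (freqBox M).filter fun j => j + n ∈ freqBox M := by
    intro j hj
    simp only [freqBox, Finset.mem_filter, Fintype.mem_piFinset, Finset.mem_Icc,
      Pi.add_apply] at hj ⊢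
    refine ⟨fun i => ?_, fun i => ?_⟩ <;> have h1 := hj i <;> have h2 := abs_le.mp (hn i) <;> omega
  have hcard := Finset.card_le_card hsub
  rw [Fintype.card_piFinset_const, Int.card_Icc] at hcard
  have h3 : (2 * (M : ℤ) + 1 - M).toNat = M + 1 := by omega
  rw [h3] at hcard
  have hcard' : ((M : ℝ) + 1) ^ 3 ≤ ((freqBox M).filter fun j => j + n ∈ freqBox M).card := by
    exact_mod_cast hcard
  rw [fejerCoeff, inv_mul_eq_div, le_div_iff₀ (card_freqBox_pos M)]
  refine le_trans ?_ hcard'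
  rw [card_freqBox]
  push_cast
  have h4 : (3 * (M : ℝ) + 1) ^ 3 ≤ (3 * (M + 1)) ^ 3 := by gcongr; linarith
  calc 1 / 27 * (3 * (M : ℝ) + 1) ^ 3 ≤ 1 / 27 * (3 * (M + 1)) ^ 3 := by gcongr
    _ = _ := by ring

/-- The Fejér kernel as a probability density. -/
def fejerMeasure (M : ℕ) : Measure (UnitAddTorus (Fin 3)) :=
  haarTorus.withDensity fun x => ENNReal.ofReal (fejer M x)

instance (M : ℕ) : IsProbabilityMeasure (fejerMeasure M) := by
  refine ⟨?_⟩
  have hint : Integrable (fejer M) haarTorus :=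
    (continuous_fejer M).integrable_of_hasCompactSupport (HasCompactSupport.of_compactSpace _)
  have h := integral_fejer_mul M 0
  simp only [mFourier_zero, ContinuousMap.one_apply, mul_one, fejerCoeff_zero] at h
  rw [integral_complex_ofReal] at h
  rw [fejerMeasure, withDensity_apply _ MeasurableSet.univ, Measure.restrict_univ,
    ← ofReal_integral_eq_lintegral_ofReal hint (Eventually.of_forall (fejer_nonneg M)),
    Complex.ofReal_injective h, ENNReal.ofReal_one]

theorem fejerMeasure_le (M : ℕ) :
    fejerMeasure M ≤ ((freqBox M).card : ℝ≥0∞) • haarTorus := by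
  rw [fejerMeasure, ← withDensity_const]
  refine withDensity_mono (Eventually.of_forall fun x => ?_)
  rw [← ENNReal.ofReal_natCast]
  exact ENNReal.ofReal_le_ofReal (fejer_le M x)

theorem trigPoly_fejer (M : ℕ) (F : Finset Freq) (f : Freq → ℂ) (x : UnitAddTorus (Fin 3)) :
    trigPoly F (fun n => fejerCoeff M n * f n) x = ∫ y, trigPoly F f (x + y) ∂fejerMeasure M := by
  have hm : Measurable fun x => Real.toNNReal (fejer M x) :=
    (continuous_fejer M).measurable.real_toNNReal
  have : fejerMeasure M = haarTorus.withDensity fun x => (Real.toNNReal (fejer M x) : ℝ≥0∞) := rfl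
  rw [this, integral_withDensity_eq_integral_smul hm]
  have h : ∀ y, Real.toNNReal (fejer M y) • trigPoly F f (x + y) =
      ∑ n ∈ F, (f n * mFourier n x) * ((fejer M y : ℂ) * mFourier n y) := by
    intro y
    rw [NNReal.smul_def, Real.coe_toNNReal _ (fejer_nonneg M y), trigPoly, Finset.smul_sum]
    refine Finset.sum_congr rfl fun n _ => ?_
    rw [mFourier_apply_add, Complex.real_smul]
    ring
  simp_rw [h]
  rw [integral_finsetSum]
  · refine Finset.sum_congr rfl fun n _ => ?_
    rw [integral_const_mul, integral_fejer_mul]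
    ring
  · intro n _
    refine Continuous.integrable_of_hasCompactSupport ?_ (HasCompactSupport.of_compactSpace _)
    have := continuous_fejer M
    fun_prop

/-- A Bernstein inequality: Jensen for the probability measure with Fejér density, then the bound of
this density by the size of the box, and invariance under translation by `x`. -/
theorem enorm_trigPoly_fejer_le (M : ℕ) (F : Finset Freq) (f : Freq → ℂ)
    (x : UnitAddTorus (Fin 3)) {q : ℝ} (hq : 1 ≤ q) :
    ‖trigPoly F (fun n => fejerCoeff M n * f n) x‖ₑ ≤
      ((freqBox M).card : ℝ≥0∞) ^ (1 / q) *
        eLpNorm (trigPoly F f) (ENNReal.ofReal q) haarTorus := by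
  have hc : Continuous fun y => trigPoly F f (x + y) :=
    (continuous_trigPoly F f).comp (continuous_const.add continuous_id)
  have hq1 : (1 : ℝ≥0∞) ≤ ENNReal.ofReal q := by simpa using hq
  rw [trigPoly_fejer]
  calc ‖∫ y, trigPoly F f (x + y) ∂fejerMeasure M‖ₑ
      ≤ ∫⁻ y, ‖trigPoly F f (x + y)‖ₑ ∂fejerMeasure M := enorm_integral_le_lintegral_enorm _
    _ = eLpNorm (fun y => trigPoly F f (x + y)) 1 (fejerMeasure M) :=
        eLpNorm_one_eq_lintegral_enorm.symm
    _ ≤ eLpNorm (fun y => trigPoly F f (x + y)) (ENNReal.ofReal q) (fejerMeasure M) :=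
        eLpNorm_le_eLpNorm_of_exponent_le hq1 hc.aestronglyMeasurable
    _ ≤ eLpNorm (fun y => trigPoly F f (x + y)) (ENNReal.ofReal q)
          (((freqBox M).card : ℝ≥0∞) • haarTorus) := eLpNorm_mono_measure _ (fejerMeasure_le M)
    _ = ((freqBox M).card : ℝ≥0∞) ^ (1 / q) *
          eLpNorm (fun y => trigPoly F f (x + y)) (ENNReal.ofReal q) haarTorus := by
        rw [eLpNorm_smul_measure_of_ne_top ENNReal.ofReal_ne_top, smul_eq_mul,
          ENNReal.toReal_div, ENNReal.toReal_one, ENNReal.toReal_ofReal (by linarith)]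
    _ = _ := by
        congr 1
        exact eLpNorm_comp_measurePreserving (continuous_trigPoly F f).aestronglyMeasurable
          (measurePreserving_add_left haarTorus x)

/-- The Fourier multiplier of the smoothing operator `∑_k 2^{-σk} F_{2^k} * ·`, which is comparable
to `⟨n⟩^{-σ}`. -/
def smoothing (σ : ℝ) (n : Freq) : ℝ := ∑' k : ℕ, ((2 : ℝ) ^ (-σ)) ^ k * fejerCoeff (2 ^ k) n

theorem summable_smoothing {σ : ℝ} (hσ : 0 < σ) (n : Freq) :
    Summable fun k : ℕ => ((2 : ℝ) ^ (-σ)) ^ k * fejerCoeff (2 ^ k) n := by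
  refine Summable.of_nonneg_of_le (fun k => mul_nonneg (by positivity) (fejerCoeff_nonneg _ _))
    (fun k => mul_le_of_le_one_right (by positivity) (fejerCoeff_le_one _ _))
    (summable_geometric_of_lt_one (by positivity) ?_)
  exact Real.rpow_lt_one_of_one_lt_of_neg one_lt_two (neg_lt_zero.mpr hσ)

theorem one_le_bracket (n : Freq) : 1 ≤ bracket n := by
  rw [bracket, Real.one_le_sqrt, le_add_iff_nonneg_right]
  positivity

theorem abs_le_bracket (n : Freq) (i : Fin 3) : |(n i : ℝ)| ≤ bracket n := by
  rw [bracket]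
  refine Real.abs_le_sqrt ?_
  have := Finset.single_le_sum (f := fun i => (n i : ℝ) ^ 2) (fun i _ => sq_nonneg _)
    (Finset.mem_univ i)
  linarith

/-- One term suffices: the index `m + 1` with `2^m ≤ ⟨n⟩ < 2^(m+1)`, where the Fejér coefficient is
at least `1/27`. -/
theorem le_smoothing {σ : ℝ} (hσ : 0 < σ) (n : Freq) :
    (2 * bracket n) ^ (-σ) / 27 ≤ smoothing σ n := by
  obtain ⟨m, hm1, hm2⟩ := exists_nat_pow_near (one_le_bracket n) (one_lt_two (α := ℝ))
  have hb := bracket_pos n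
  have h1 : 1 / 27 ≤ fejerCoeff (2 ^ (m + 1)) n := by
    refine le_fejerCoeff fun i => ?_
    have := (abs_le_bracket n i).trans hm2.le
    exact_mod_cast this
  have h2 : (2 * bracket n) ^ (-σ) ≤ ((2 : ℝ) ^ (-σ)) ^ (m + 1) := by
    rw [← Real.rpow_natCast, ← Real.rpow_mul zero_le_two, mul_comm (-σ), Real.rpow_mul zero_le_two,
      Real.rpow_natCast]
    refine Real.rpow_le_rpow_of_nonpos (by positivity) ?_ (by linarith)
    rw [pow_succ, mul_comm]
    linarith
  calc (2 * bracket n) ^ (-σ) / 27 = (2 * bracket n) ^ (-σ) * (1 / 27) := by ring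
    _ ≤ ((2 : ℝ) ^ (-σ)) ^ (m + 1) * fejerCoeff (2 ^ (m + 1)) n := by gcongr
    _ ≤ smoothing σ n := (summable_smoothing hσ n).le_tsum (m + 1) fun k _ =>
        mul_nonneg (by positivity) (fejerCoeff_nonneg _ _)

theorem smoothing_pos {σ : ℝ} (hσ : 0 < σ) (n : Freq) : 0 < smoothing σ n := by
  have := bracket_pos n
  exact lt_of_lt_of_le (by positivity) (le_smoothing hσ n)

theorem inv_smoothing_le {σ : ℝ} (hσ : 0 < σ) (n : Freq) :
    (smoothing σ n)⁻¹ ≤ 27 * 2 ^ σ * bracket n ^ σ := by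
  have hb := bracket_pos n
  refine (inv_anti₀ (by positivity) (le_smoothing hσ n)).trans_eq ?_
  rw [Real.rpow_neg (by positivity), Real.mul_rpow zero_le_two hb.le, inv_div, div_inv_eq_mul]
  ring

/-- The constant of the embedding into `L^∞`. -/
def embConst (σ : ℝ) : ℝ≥0∞ :=
  ∑' k : ℕ, ENNReal.ofReal (2 ^ (3 * σ / 2) * ((2 : ℝ) ^ (-σ / 4)) ^ k)

theorem embConst_ne_top {σ : ℝ} (hσ : 0 < σ) : embConst σ ≠ ∞ := by
  refine Summable.tsum_ofReal_ne_top ((summable_geometric_of_lt_one (by positivity) ?_).mul_left _)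
  exact Real.rpow_lt_one_of_one_lt_of_neg one_lt_two (by linarith)

/-- The box has at most `2^{3(k+2)}` points, and its power `σ/4` loses `2^{3σ(k+2)/4}` against the
gain `2^{-σk}`. The geometric decay `2^{-σk/4}` remains because the exponent `4/σ` exceeds the
critical `3/σ`. -/
theorem geom_mul_card_freqBox_le {σ : ℝ} (hσ : 0 < σ) (k : ℕ) :
    ENNReal.ofReal (((2 : ℝ) ^ (-σ)) ^ k) *
      ((freqBox (2 ^ k)).card : ℝ≥0∞) ^ (1 / (4 / σ)) ≤
    ENNReal.ofReal (2 ^ (3 * σ / 2) * ((2 : ℝ) ^ (-σ / 4)) ^ k) := by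
  rw [← ENNReal.ofReal_natCast, ENNReal.ofReal_rpow_of_nonneg (by positivity) (by positivity),
    ← ENNReal.ofReal_mul (by positivity)]
  refine ENNReal.ofReal_le_ofReal ?_
  have h1 : ((freqBox (2 ^ k)).card : ℝ) ≤ (2 : ℝ) ^ (3 * (k + 2) : ℝ) := by
    rw [card_freqBox]
    push_cast
    have h2 : (3 * (2 : ℝ) ^ k + 1) ≤ 2 ^ (k + 2) := by
      have := one_le_pow₀ (one_le_two (α := ℝ)) (n := k)
      rw [pow_add]; linarith
    calc (3 * (2 : ℝ) ^ k + 1) ^ 3 ≤ (2 ^ (k + 2)) ^ 3 := by gcongr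
      _ = _ := by
        rw [← pow_mul, ← Real.rpow_natCast]
        push_cast
        ring_nf
  calc ((2 : ℝ) ^ (-σ)) ^ k * ((freqBox (2 ^ k)).card : ℝ) ^ (1 / (4 / σ))
      ≤ ((2 : ℝ) ^ (-σ)) ^ k * ((2 : ℝ) ^ (3 * (k + 2) : ℝ)) ^ (1 / (4 / σ)) := by gcongr
    _ = _ := by
      rw [← Real.rpow_natCast, ← Real.rpow_natCast, ← Real.rpow_mul zero_le_two,
        ← Real.rpow_mul zero_le_two, ← Real.rpow_mul zero_le_two, ← Real.rpow_add zero_lt_two,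
        ← Real.rpow_add zero_lt_two]
      congr 1
      field_simp
      ring

/-- The Sobolev embedding `W^{σ,4/σ} ⊆ L^∞` for trigonometric polynomials. -/
theorem eLpNorm_top_trigPoly_le {σ : ℝ} (hσ : 0 < σ) (hσ4 : σ ≤ 4) (F : Finset Freq)
    (f : Freq → ℂ) :
    eLpNorm (trigPoly F f) ∞ torusMeasure ≤ embConst σ *
      eLpNorm (trigPoly F fun n => ((smoothing σ n)⁻¹ : ℝ) * f n) (ENNReal.ofReal (4 / σ))
        haarTorus := by
  set g : Freq → ℂ := fun n => ((smoothing σ n)⁻¹ : ℝ) * f n with hg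
  have hq : 1 ≤ 4 / σ := by rwa [le_div_iff₀ hσ, one_mul]
  rw [eLpNorm_exponent_top]
  refine eLpNormEssSup_le_of_ae_enorm_bound (Eventually.of_forall fun x => ?_)
  -- Since `f = smoothing σ · g`, the polynomial of `f` is the dyadic sum of the Fejér means of that
  -- of `g`; each mean is bounded pointwise by the `L^{4/σ}` norm of the latter.
  have hsum : HasSum (fun k : ℕ => ((((2 : ℝ) ^ (-σ)) ^ k : ℝ) : ℂ) *
      trigPoly F (fun n => fejerCoeff (2 ^ k) n * g n) x) (trigPoly F f x) := by
    simp only [trigPoly, Finset.mul_sum]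
    refine hasSum_sum fun n _ => ?_
    have h := (Complex.hasSum_ofReal.mpr (summable_smoothing hσ n).hasSum).mul_right
      (g n * mFourier n x)
    have h' : (((∑' k : ℕ, ((2 : ℝ) ^ (-σ)) ^ k * fejerCoeff (2 ^ k) n : ℝ) : ℂ)) *
        (g n * mFourier n x) = f n * mFourier n x := by
      have hne : (smoothing σ n : ℂ) ≠ 0 := by exact_mod_cast (smoothing_pos hσ n).ne'
      change (smoothing σ n : ℂ) * _ = _
      rw [hg]
      push_cast
      field_simp
    rw [h'] at h
    refine h.congr_fun fun k => ?_
    push_cast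
    ring
  rw [← hsum.tsum_eq, embConst, ← ENNReal.tsum_mul_right]
  refine enorm_tsum_le_tsum_enorm.trans (ENNReal.tsum_le_tsum fun k => ?_)
  rw [enorm_mul, ← ofReal_norm, Complex.norm_real, Real.norm_of_nonneg (by positivity)]
  calc _ ≤ ENNReal.ofReal (((2 : ℝ) ^ (-σ)) ^ k) * (((freqBox (2 ^ k)).card : ℝ≥0∞) ^ (1 / (4 / σ)) *
        eLpNorm (trigPoly F g) (ENNReal.ofReal (4 / σ)) haarTorus) := by
        gcongr
        exact enorm_trigPoly_fejer_le (2 ^ k) F g x hq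
    _ ≤ _ := by
        rw [← mul_assoc]
        gcongr
        exact geom_mul_card_freqBox_le hσ k

/-! ### Moments of sub-Gaussian sums -/

/-- The inequality `y ≤ e^y` at `y = l|x|/p`, raised to the power `p`. -/
theorem abs_rpow_le_exp_add_exp {p l : ℝ} (hp : 0 < p) (hl : 0 < l) (x : ℝ) :
    |x| ^ p ≤ (p / l) ^ p * (Real.exp (l * x) + Real.exp (-l * x)) := by
  have h1 : l * |x| / p ≤ Real.exp (l * |x| / p) :=
    (le_add_of_nonneg_right zero_le_one).trans (Real.add_one_le_exp _)
  have h2 : |x| ≤ p / l * Real.exp (l * |x| / p) := by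
    calc |x| = p / l * (l * |x| / p) := by field_simp
      _ ≤ _ := by gcongr
  have h3 : Real.exp (l * |x| / p) ^ p = Real.exp (l * |x|) := by
    rw [← Real.exp_mul]
    congr 1
    field_simp
  calc |x| ^ p ≤ (p / l * Real.exp (l * |x| / p)) ^ p := by gcongr
    _ = (p / l) ^ p * Real.exp (l * |x|) := by
      rw [Real.mul_rpow (by positivity) (by positivity), h3]
    _ ≤ _ := by
      gcongr
      rcases abs_cases x with ⟨h, _⟩ | ⟨h, _⟩ <;> rw [h]
      · linarith [Real.exp_pos (-l * x)]
      · rw [mul_neg, ← neg_mul]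
        linarith [Real.exp_pos (l * x)]

theorem eLpNorm_le_of_hasSubgaussianMGF {Ω : Type*} [MeasurableSpace Ω] {P : Measure Ω}
    {X : Ω → ℝ} {v : ℝ≥0} (hX : HasSubgaussianMGF X v P) {p : ℝ} (hp : 1 ≤ p) :
    eLpNorm X (ENNReal.ofReal p) P ≤ ENNReal.ofReal (4 * √p * √v) := by
  have hp0 : 0 < p := by linarith
  rcases eq_or_ne v 0 with rfl | hv
  · rw [eLpNorm_congr_ae hX.ae_eq_zero_of_hasSubgaussianMGF_zero]
    simp
  have hv0 : (0 : ℝ) < v := by exact_mod_cast pos_iff_ne_zero.mpr hv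
  -- With this choice both exponential moments are at most `e^{p/2}`, while the prefactor `p/l`
  -- equals `√p √v`.
  set l : ℝ := √p / √v with hl
  have hl0 : 0 < l := by positivity
  have hpl : p / l = √p * √v := by
    rw [hl]
    field_simp
    rw [Real.sq_sqrt hp0.le]
  have hlv : ∀ l' : ℝ, l' ^ 2 = l ^ 2 → mgf X P l' ≤ Real.exp (p / 2) := by
    intro l' h
    refine (hX.mgf_le l').trans_eq ?_
    rw [h, hl, div_pow, Real.sq_sqrt hp0.le, Real.sq_sqrt hv0.le]
    congr 1
    field_simp
  have hint : Integrable (fun ω => Real.exp (l * X ω) + Real.exp (-l * X ω)) P :=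
    (hX.integrable_exp_mul l).add (hX.integrable_exp_mul (-l))
  have hbound : ∫⁻ ω, ‖X ω‖ₑ ^ p ∂P ≤ ENNReal.ofReal ((4 * √p * √v) ^ p) := by
    calc ∫⁻ ω, ‖X ω‖ₑ ^ p ∂P
        ≤ ∫⁻ ω, ENNReal.ofReal ((p / l) ^ p * (Real.exp (l * X ω) + Real.exp (-l * X ω))) ∂P := by
          refine lintegral_mono fun ω => ?_
          rw [Real.enorm_eq_ofReal_abs, ENNReal.ofReal_rpow_of_nonneg (abs_nonneg _) hp0.le]
          exact ENNReal.ofReal_le_ofReal (abs_rpow_le_exp_add_exp hp0 hl0 _)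
      _ = ENNReal.ofReal ((p / l) ^ p * (mgf X P l + mgf X P (-l))) := by
          rw [← ofReal_integral_eq_lintegral_ofReal (hint.const_mul _)
            (Eventually.of_forall fun ω => by positivity), integral_const_mul,
            integral_add (hX.integrable_exp_mul l) (hX.integrable_exp_mul (-l))]
          rfl
      _ ≤ _ := by
          refine ENNReal.ofReal_le_ofReal ?_
          have h1 := hlv l rfl
          have h2 := hlv (-l) (by ring)
          -- From `e^{1/2} ≤ 2`; the sum of the two exponential moments is then at most `2 · 2^p ≤
          -- 4^p`, whence the constant 4.
          have h3 : Real.exp (p / 2) ≤ 2 ^ p / 1 := by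
            have : Real.exp (p / 2) = (Real.exp (1 / 2)) ^ p := by
              rw [← Real.exp_mul]; congr 1; ring
            rw [this, div_one]
            gcongr
            have h4 : Real.exp (1 / 2) ^ 2 ≤ 2 ^ 2 := by
              rw [← Real.exp_nat_mul]
              norm_num
              linarith [Real.exp_one_lt_d9]
            exact (sq_le_sq₀ (by positivity) (by norm_num)).mp h4
          have h5 : (2 : ℝ) ≤ 2 ^ p := by
            simpa using Real.rpow_le_rpow_of_exponent_le one_le_two hp
          calc (p / l) ^ p * (mgf X P l + mgf X P (-l))
              ≤ (p / l) ^ p * (2 ^ p * 2 ^ p) := by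
                gcongr
                nlinarith
            _ = _ := by
                rw [hpl, mul_assoc 4, show (4 : ℝ) = 2 * 2 by norm_num,
                  Real.mul_rpow (x := 2 * 2) (by positivity) (by positivity),
                  Real.mul_rpow (x := 2) (by positivity) (by positivity)]
                ring
  rw [eLpNorm_eq_lintegral_rpow_enorm_toReal (by simpa using hp0) ENNReal.ofReal_ne_top,
    ENNReal.toReal_ofReal hp0.le]
  calc _ ≤ (ENNReal.ofReal ((4 * √p * √v) ^ p)) ^ (1 / p) := by gcongr
    _ = _ := by
      rw [← ENNReal.ofReal_rpow_of_nonneg (by positivity) hp0.le, ← ENNReal.rpow_mul,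
        mul_one_div_cancel hp0.ne', ENNReal.rpow_one]

/-- Khintchine's inequality for independent sub-Gaussian variables and real coefficients. -/
theorem eLpNorm_sum_mul_le_real {Ω ι κ : Type*} [MeasurableSpace Ω] {P : Measure Ω}
    {ξ : ι → Ω → ℝ} (hind : iIndepFun ξ P) {c : ℝ≥0} (hξ : ∀ i, HasSubgaussianMGF (ξ i) c P)
    {e : κ → ι} (he : Function.Injective e) (F : Finset κ) (a : κ → ℝ) {B : ℝ}
    (hB : 0 ≤ B) (ha : ∑ k ∈ F, a k ^ 2 ≤ B ^ 2) {p : ℝ} (hp : 1 ≤ p) :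
    eLpNorm (fun ω => ∑ k ∈ F, a k * ξ (e k) ω) (ENNReal.ofReal p) P ≤
      ENNReal.ofReal (4 * √c * √p * B) := by
  have hk : ∀ k, HasSubgaussianMGF (fun ω => a k * ξ (e k) ω) ((a k ^ 2).toNNReal * c) P := by
    intro k
    rw [Real.toNNReal_of_nonneg (sq_nonneg (a k))]
    exact (hξ (e k)).const_mul (a k)
  have h := HasSubgaussianMGF.sum_of_iIndepFun (s := F)
    ((hind.precomp he).comp (fun k x => a k * x) fun k => measurable_const_mul (a k))
    fun k _ => hk k
  refine (eLpNorm_le_of_hasSubgaussianMGF h hp).trans (ENNReal.ofReal_le_ofReal ?_)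
  calc _ ≤ 4 * √p * (√c * B) := by
        gcongr
        rw [← Finset.sum_mul, NNReal.coe_mul, Real.sqrt_mul (by positivity), mul_comm]
        gcongr
        simp only [NNReal.coe_sum, Real.coe_toNNReal _ (sq_nonneg _)]
        exact Real.sqrt_le_iff.mpr ⟨hB, ha⟩
    _ = _ := by ring

/-- Khintchine's inequality for independent sub-Gaussian variables and complex coefficients. -/
theorem eLpNorm_sum_mul_le {Ω ι κ : Type*} [MeasurableSpace Ω] {P : Measure Ω}
    {ξ : ι → Ω → ℝ} (hind : iIndepFun ξ P) {c : ℝ≥0} (hξ : ∀ i, HasSubgaussianMGF (ξ i) c P)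
    {e : κ → ι} (he : Function.Injective e) (F : Finset κ) (a : κ → ℂ) {B : ℝ}
    (hB : 0 ≤ B) (ha : ∑ k ∈ F, ‖a k‖ ^ 2 ≤ B ^ 2) {p : ℝ} (hp : 1 ≤ p) :
    eLpNorm (fun ω => ∑ k ∈ F, a k * ξ (e k) ω) (ENNReal.ofReal p) P ≤
      ENNReal.ofReal (8 * √c * √p * B) := by
  have hre : ∑ k ∈ F, (a k).re ^ 2 ≤ B ^ 2 := by
    refine le_trans (Finset.sum_le_sum fun k _ => ?_) ha
    rw [Complex.sq_norm, Complex.normSq_apply]; nlinarith [sq_nonneg (a k).im]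
  have him : ∑ k ∈ F, (a k).im ^ 2 ≤ B ^ 2 := by
    refine le_trans (Finset.sum_le_sum fun k _ => ?_) ha
    rw [Complex.sq_norm, Complex.normSq_apply]; nlinarith [sq_nonneg (a k).re]
  have h1 := eLpNorm_sum_mul_le_real hind hξ he F (fun k => (a k).re) hB hre hp
  have h2 := eLpNorm_sum_mul_le_real hind hξ he F (fun k => (a k).im) hB him hp
  have hm : ∀ b : κ → ℝ, AEStronglyMeasurable (fun ω => ∑ k ∈ F, b k * ξ (e k) ω) P := fun b =>
    Finset.aestronglyMeasurable_fun_sum _ fun k _ => (hξ (e k)).aestronglyMeasurable.const_mul (b k)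
  calc eLpNorm (fun ω => ∑ k ∈ F, a k * ξ (e k) ω) (ENNReal.ofReal p) P
      ≤ eLpNorm ((fun ω => ‖∑ k ∈ F, (a k).re * ξ (e k) ω‖) +
          fun ω => ‖∑ k ∈ F, (a k).im * ξ (e k) ω‖) (ENNReal.ofReal p) P := by
        refine eLpNorm_mono_real fun ω => ?_
        refine (Complex.norm_le_abs_re_add_abs_im _).trans_eq ?_
        simp [Complex.re_sum, Complex.im_sum]
    _ ≤ _ := by
        refine (eLpNorm_add_le (hm _).norm (hm _).norm (by simpa using hp)).trans ?_
        rw [eLpNorm_norm, eLpNorm_norm]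
        refine (add_le_add h1 h2).trans_eq ?_
        rw [← ENNReal.ofReal_add (by positivity) (by positivity)]
        congr 1
        ring

/-- `HasSubgaussianMGF` is normalized by `e^{vγ²/2}`, so the bound `e^{cγ²}` corresponds to `v =
2c`. -/
theorem SubGaussianLaw.hasSubgaussianMGF {Ω : Type*} [MeasurableSpace Ω] {P : Measure Ω}
    {θ : Measure ℝ} {c : ℝ} (hc : 0 ≤ c) (hθ : SubGaussianLaw c θ) {X : Ω → ℝ}
    (hX : Measurable X) (hlaw : P.map X = θ) :
    HasSubgaussianMGF X (2 * c).toNNReal P := by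
  rw [← HasSubgaussianMGF.id_map_iff hX.aemeasurable, hlaw]
  refine ⟨fun t => (hθ t).1, fun t => (hθ t).2.trans_eq ?_⟩
  rw [Real.coe_toNNReal _ (by positivity)]
  congr 1
  ring

/-! ### Fourier coefficients of the free evolution -/

theorem HSob.isometry_toLp (s : ℝ) : Isometry (HSob.toLp s) :=
  AddMonoidHomClass.isometry_of_norm (HSob.toLp s) fun _ => rfl

theorem HSob.continuous_coeff (s : ℝ) (n : Freq) : Continuous fun f : HSob s => f.1 n := by
  have h0 : Continuous fun f : HSob s => HSob.toLp s f n :=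
    ((continuous_apply n).comp lp.uniformContinuous_coe.continuous).comp
      (HSob.isometry_toLp s).continuous
  have h := h0.const_smul (bracket n ^ s)⁻¹
  convert h using 2 with f
  exact (inv_smul_smul₀ (Real.rpow_pos_of_pos (bracket_pos n) s).ne' (f.1 n)).symm

theorem one_le_timeBracket (t : ℝ) : 1 ≤ timeBracket t := by
  rw [timeBracket, Real.one_le_sqrt, le_add_iff_nonneg_right]
  positivity

theorem abs_le_timeBracket (t : ℝ) : |t| ≤ timeBracket t := Real.abs_le_sqrt (by linarith)

/-- The Fourier multipliers `cos(t|n|)` and `sin(t|n|)/|n|` of the free evolution. -/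
def waveMul (t : ℝ) (n : Freq) : Fin 2 → ℂ :=
  ![(Real.cos (t * len n) : ℂ),
    if n = 0 then (t : ℂ) else ((Real.sin (t * len n) / len n : ℝ) : ℂ)]

theorem freeEvolution_eq {s : ℝ} (t : ℝ) (v : Data s) (n : Freq) :
    freeEvolution t v n = waveMul t n 0 * v.1.1 n + waveMul t n 1 * v.2.1 n := rfl

theorem bracket_le_two_mul_len {n : Freq} (hn : n ≠ 0) : bracket n ≤ 2 * len n := by
  obtain ⟨i, hi⟩ := Function.ne_iff.mp hn
  have h1 : (1 : ℝ) ≤ (n i : ℝ) ^ 2 := by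
    have : 0 < (n i) ^ 2 := sq_pos_of_ne_zero hi
    exact_mod_cast this
  have h2 := Finset.single_le_sum (f := fun i => (n i : ℝ) ^ 2) (fun i _ => sq_nonneg _)
    (Finset.mem_univ i)
  rw [bracket, len]
  refine Real.sqrt_le_iff.mpr ⟨by positivity, ?_⟩
  rw [mul_pow, Real.sq_sqrt (by positivity)]
  linarith

/-- The factor `⟨t⟩` is needed only for the zero mode of the velocity, where the multiplier is `t`.
For `n ≠ 0`, `|sin| ≤ 1` and `⟨n⟩ ≤ 2|n|` give the gain of one derivative. -/
theorem norm_waveMul_le (t : ℝ) (n : Freq) (j : Fin 2) :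
    ‖waveMul t n j‖ ≤ 2 * timeBracket t * bracket n ^ (-(j : ℝ)) := by
  have ht := one_le_timeBracket t
  have hb := bracket_pos n
  fin_cases j
  · have h := Real.abs_cos_le_one (t * len n)
    simp only [waveMul, Fin.zero_eta, Matrix.cons_val_zero, Complex.norm_real, Real.norm_eq_abs,
      Nat.cast_zero, neg_zero, Real.rpow_zero]
    linarith
  · simp only [waveMul, Fin.mk_one, Matrix.cons_val_one, Matrix.cons_val_fin_one,
      Nat.cast_one, Real.rpow_neg_one]
    split_ifs with h
    · have : bracket n = 1 := by simp [h, bracket]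
      rw [this, inv_one, mul_one, Complex.norm_real, Real.norm_eq_abs]
      linarith [abs_le_timeBracket t]
    · have hl := bracket_le_two_mul_len h
      have hl0 : 0 < len n := by linarith
      have hs := Real.abs_sin_le_one (t * len n)
      rw [Complex.norm_real, Real.norm_eq_abs, abs_div, abs_of_pos hl0, ← div_eq_mul_inv,
        div_le_div_iff₀ hl0 hb]
      nlinarith [mul_le_mul_of_nonneg_right ht hl0.le, mul_le_mul_of_nonneg_right hs hb.le]

theorem measurable_waveMul (n : Freq) (j : Fin 2) : Measurable fun t => waveMul t n j := by
  fin_cases j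
  · simp only [waveMul, Fin.zero_eta, Matrix.cons_val_zero]
    fun_prop
  · simp only [waveMul, Fin.mk_one, Matrix.cons_val_one, Matrix.cons_val_fin_one]
    split_ifs <;> fun_prop

theorem memℓp_freeEvolution {s : ℝ} (hs : 0 ≤ s) (t : ℝ) (v : Data s) :
    Memℓp (freeEvolution t v) 2 := by
  rw [memℓp_gen_iff (by norm_num)]
  simp only [ENNReal.toReal_ofNat, Real.rpow_two]
  have h0 : Summable fun n => bracket n ^ (2 * s) * ‖v.1.1 n‖ ^ 2 := v.1.2.2
  have h1 : Summable fun n => bracket n ^ (2 * (s - 1)) * ‖v.2.1 n‖ ^ 2 := v.2.2.2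
  have ht := one_le_timeBracket t
  refine Summable.of_nonneg_of_le (fun n => by positivity) (fun n => ?_)
    ((h0.add h1).mul_left (8 * timeBracket t ^ 2))
  have hb := one_le_bracket n
  have hb0 := bracket_pos n
  have hw0 := norm_waveMul_le t n 0
  have hw1 := norm_waveMul_le t n 1
  simp only [Fin.val_zero, Nat.cast_zero, neg_zero, Real.rpow_zero, mul_one, Fin.val_one,
    Nat.cast_one] at hw0 hw1
  have hp : 1 ≤ bracket n ^ (2 * s) := Real.one_le_rpow hb (by linarith)
  have hsq1 : ‖waveMul t n 1‖ ^ 2 ≤ 4 * timeBracket t ^ 2 * bracket n ^ (2 * (s - 1)) := by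
    calc ‖waveMul t n 1‖ ^ 2 ≤ (2 * timeBracket t * bracket n ^ (-1 : ℝ)) ^ 2 := by gcongr
      _ = 4 * timeBracket t ^ 2 * bracket n ^ (-2 : ℝ) := by
        rw [mul_pow, ← Real.rpow_natCast (bracket n ^ (-1 : ℝ)), ← Real.rpow_mul hb0.le]
        rw [show (-1 : ℝ) * ((2 : ℕ) : ℝ) = -2 by norm_num]
        ring
      _ ≤ _ := by
        gcongr
        linarith
  have hsq0 : ‖waveMul t n 0‖ ^ 2 ≤ 4 * timeBracket t ^ 2 * bracket n ^ (2 * s) := by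
    calc ‖waveMul t n 0‖ ^ 2 ≤ (2 * timeBracket t) ^ 2 := by gcongr
      _ = 4 * timeBracket t ^ 2 * 1 := by ring
      _ ≤ _ := by gcongr
  rw [freeEvolution_eq]
  calc _ ≤ (‖waveMul t n 0‖ * ‖v.1.1 n‖ + ‖waveMul t n 1‖ * ‖v.2.1 n‖) ^ 2 := by
        gcongr
        exact (norm_add_le _ _).trans (by rw [norm_mul, norm_mul])
    _ ≤ 2 * (‖waveMul t n 0‖ ^ 2 * ‖v.1.1 n‖ ^ 2 + ‖waveMul t n 1‖ ^ 2 * ‖v.2.1 n‖ ^ 2) := by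
        rw [← mul_pow, ← mul_pow]
        exact add_sq_le
    _ ≤ 2 * ((4 * timeBracket t ^ 2 * bracket n ^ (2 * s)) * ‖v.1.1 n‖ ^ 2 +
          (4 * timeBracket t ^ 2 * bracket n ^ (2 * (s - 1))) * ‖v.2.1 n‖ ^ 2) := by gcongr
    _ = _ := by ring

theorem measurable_torusLpNorm_freeEvolution {s : ℝ} (hs : 0 ≤ s) {q : ℝ≥0∞} (hq : 2 ≤ q) :
    Measurable fun z : ℝ × Data s => torusLpNorm q (freeEvolution z.1 z.2) := by
  refine measurable_torusLpNorm hq (fun z => memℓp_freeEvolution hs z.1 z.2) fun n => ?_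
  simp only [freeEvolution_eq]
  have h0 := (HSob.continuous_coeff s n).measurable
  have h1 := (HSob.continuous_coeff (s - 1) n).measurable
  have hw0 := measurable_waveMul n 0
  have hw1 := measurable_waveMul n 1
  exact ((hw0.comp measurable_fst).mul (h0.comp (measurable_fst.comp measurable_snd))).add
    ((hw1.comp measurable_fst).mul (h1.comp (measurable_snd.comp measurable_snd)))

/-! ### Real Fourier series -/

/-- The mode `cos(k·x)`, also for `k = 0`. -/
def modeCos (k : Freq) : Mode := if h : k = 0 then Mode.const else Mode.cos ⟨k, h⟩

/-- The mode `sin(k·x)`, with the constant mode as a placeholder for `k = 0`. -/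
def modeSin (k : Freq) : Mode := if h : k = 0 then Mode.const else Mode.sin ⟨k, h⟩

theorem modeCos_injective : Function.Injective modeCos := by
  intro k l h
  by_cases hk : k = 0 <;> by_cases hl : l = 0 <;> simp_all [modeCos]

theorem modeSin_injective : Function.Injective modeSin := by
  intro k l h
  by_cases hk : k = 0 <;> by_cases hl : l = 0 <;> simp_all [modeSin]

/-- The four modes that contribute to the Fourier coefficient of index `k`. -/
def slot (r : Fin 4) (k : Freq) : Mode := ![modeCos k, modeCos (-k), modeSin k, modeSin (-k)] r

/-- The weights with which they contribute. -/
def slotWeight : Fin 4 → ℂ := ![1 / 2, 1 / 2, 1 / (2 * Complex.I), -1 / (2 * Complex.I)]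

/-- Within one slot distinct frequencies carry distinct, hence independent, variables. This fails
for the full coefficients, since those at `k` and `-k` use the same modes. -/
theorem slot_injective (r : Fin 4) : Function.Injective (slot r) := by
  fin_cases r
  · exact modeCos_injective
  · exact modeCos_injective.comp neg_injective
  · exact modeSin_injective
  · exact modeSin_injective.comp neg_injective

theorem norm_slotWeight (r : Fin 4) : ‖slotWeight r‖ = 1 / 2 := by
  fin_cases r <;> simp [slotWeight]

theorem fourierOfTrig_eq (A : Mode → ℝ) (k : Freq) :
    fourierOfTrig A k = ∑ r, slotWeight r * A (slot r k) := by
  simp only [Fin.sum_univ_four, slotWeight, slot, Matrix.cons_val_zero, Matrix.cons_val_one,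
    Matrix.cons_val]
  -- At `k = 0` all four slots are the constant mode: the sine weights cancel and the cosine weights
  -- add up to 1.
  by_cases h : k = 0
  · simp only [fourierOfTrig, h, modeCos, modeSin, neg_zero, dif_pos]
    ring
  · simp only [fourierOfTrig, h, modeCos, modeSin, neg_eq_zero, dif_neg, not_false_eq_true,
      FreqStar.opp]
    push_cast
    ring

/-- For `k ≠ 0`, `4|f(k)|² = (b + b')² + (c - c')²`, and the conditions `bb' ≥ 0`, `cc' ≤ 0` make
the cross terms nonnegative. Without them the series could have large terms that cancel in `f` but
not after randomization. -/
theorem sq_mode_le {A : Mode → ℝ} {f : Freq → ℂ} (h : IsTrigSeriesOf A f) (k : Freq) :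
    A (modeCos k) ^ 2 ≤ 4 * ‖f k‖ ^ 2 ∧ A (modeSin k) ^ 2 ≤ 4 * ‖f k‖ ^ 2 := by
  obtain ⟨h1, h2, h3⟩ := h
  rw [h1 k]
  by_cases hk : k = 0
  · simp only [modeCos, modeSin, fourierOfTrig, hk, dif_pos, Complex.norm_real, Real.norm_eq_abs,
      sq_abs]
    constructor <;> nlinarith [sq_nonneg (A Mode.const)]
  · have h2' := h2 ⟨k, hk⟩
    have h3' := h3 ⟨k, hk⟩
    simp only [modeCos, modeSin, fourierOfTrig, hk, dif_neg, not_false_eq_true]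
    set b := A (Mode.cos ⟨k, hk⟩)
    set b' := A (Mode.cos (FreqStar.opp ⟨k, hk⟩))
    set c := A (Mode.sin ⟨k, hk⟩)
    set c' := A (Mode.sin (FreqStar.opp ⟨k, hk⟩))
    have : 4 * ‖((b + b' : ℝ) : ℂ) / 2 + ((c - c' : ℝ) : ℂ) / (2 * Complex.I)‖ ^ 2 =
        (b + b') ^ 2 + (c - c') ^ 2 := by
      rw [Complex.sq_norm, Complex.normSq_apply]
      simp [Complex.div_re, Complex.div_im, Complex.normSq]
      ring
    rw [this]
    constructor <;> nlinarith [sq_nonneg b, sq_nonneg b', sq_nonneg c, sq_nonneg c',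
      sq_nonneg (b + b'), sq_nonneg (c - c')]

theorem sq_slot_le {A : Mode → ℝ} {f : Freq → ℂ} (h : IsTrigSeriesOf A f) (r : Fin 4) (k : Freq) :
    A (slot r k) ^ 2 ≤ 4 * ‖f k‖ ^ 2 := by
  have hneg : ‖f (-k)‖ = ‖f k‖ := by
    rw [h.1, h.1, fourierOfTrig_neg]
    exact norm_star _
  fin_cases r
  · exact (sq_mode_le h k).1
  · have := (sq_mode_le h (-k)).1
    rwa [hneg] at this
  · exact (sq_mode_le h k).2
  · have := (sq_mode_le h (-k)).2
    rwa [hneg] at this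

/-! ### Regularity and measurability of the randomization -/

theorem hasSobolevRegularity_iff_tsum_ne_top (s : ℝ) (f : Freq → ℂ) :
    HasSobolevRegularity s f ↔
      ∑' n, ENNReal.ofReal (bracket n ^ (2 * s) * ‖f n‖ ^ 2) ≠ ∞ := by
  have hnn : ∀ n, 0 ≤ bracket n ^ (2 * s) * ‖f n‖ ^ 2 := fun n => by
    have := bracket_pos n
    positivity
  refine ⟨fun h => h.tsum_ofReal_ne_top, fun h => ?_⟩
  refine (ENNReal.summable_toReal h).congr fun n => ?_
  rw [ENNReal.toReal_ofReal (hnn n)]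

theorem measurable_fourierOfTrig {Ω : Type*} [MeasurableSpace Ω] {a : Ω → Mode → ℝ}
    (ha : ∀ m, Measurable fun ω => a ω m) (n : Freq) :
    Measurable fun ω => fourierOfTrig (a ω) n := by
  simp only [fourierOfTrig_eq]
  exact Finset.measurable_fun_sum _ fun r _ =>
    (Complex.measurable_ofReal.comp (ha _)).const_mul _

theorem measurableSet_hasSobolevRegularity {Ω : Type*} [MeasurableSpace Ω] (s : ℝ)
    {f : Ω → Freq → ℂ} (hf : ∀ n, Measurable fun ω => f ω n) :
    MeasurableSet {ω | HasSobolevRegularity s (f ω)} := by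
  simp only [hasSobolevRegularity_iff_tsum_ne_top]
  refine (measurableSet_singleton ∞).compl.preimage (Measurable.tsum fun n => ?_)
  have := hf n
  fun_prop

/-- The weighted coefficients embed `H^s` isometrically into `ℓ²`, where every point is the limit of
its truncations, and each truncation is a continuous function of finitely many coefficients. -/
theorem measurable_of_coeff {Ω : Type*} [MeasurableSpace Ω] {s : ℝ} {f : Ω → HSob s}
    (hf : ∀ n, Measurable fun ω => (f ω).1 n) : Measurable f := by
  let : MeasurableSpace (lp (fun _ : Freq => ℂ) 2) := borel _
  have : BorelSpace (lp (fun _ : Freq => ℂ) 2) := ⟨rfl⟩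
  have h1 : Measurable fun ω => HSob.toLp s (f ω) := by
    refine measurable_of_tendsto_metrizable' (atTop : Filter (Finset Freq))
      (f := fun F ω => ∑ n ∈ F, lp.single 2 n (HSob.toLp s (f ω) n)) (fun F => ?_)
      (tendsto_pi_nhds.mpr fun ω => lp.hasSum_single (by simp) (HSob.toLp s (f ω)))
    have hc : Continuous fun b : F → ℂ =>
        (∑ n : F, lp.single 2 n.1 (bracket n.1 ^ s • b n) : lp (fun _ : Freq => ℂ) 2) := by
      refine continuous_finsetSum _ fun n _ => ?_
      have h : Continuous fun b : F → ℂ => bracket n.1 ^ s • b n := by fun_prop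
      exact (lp.isometry_single n.1).continuous.comp h
    convert hc.measurable.comp (measurable_pi_lambda
      (fun ω (n : F) => (f ω).1 n.1) fun n => hf n.1) using 2 with ω
    exact (Finset.sum_coe_sort F fun n =>
      lp.single (E := fun _ : Freq => ℂ) 2 n (bracket n ^ s • (f ω).1 n)).symm
  refine measurable_of_isOpen fun U hU => ?_
  obtain ⟨V, hV, rfl⟩ := (HSob.isometry_toLp s).isUniformInducing.isInducing.isOpen_iff.mp hU
  exact h1 hV.measurableSet

theorem coe_trigSum_of_regular {s : ℝ} {A : Mode → ℝ}
    (h : HasSobolevRegularity s (fourierOfTrig A)) : (trigSum s A).1 = fourierOfTrig A :=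
  congrArg Subtype.val (dif_pos h : trigSum s A = ⟨fourierOfTrig A, fourierOfTrig_neg A, h⟩)

theorem coe_trigSum_of_not_regular {s : ℝ} {A : Mode → ℝ}
    (h : ¬HasSobolevRegularity s (fourierOfTrig A)) : (trigSum s A).1 = 0 :=
  congrArg Subtype.val (dif_neg h : trigSum s A = 0)

theorem measurable_trigSum {Ω : Type*} [MeasurableSpace Ω] (s : ℝ) {a : Ω → Mode → ℝ}
    (ha : ∀ m, Measurable fun ω => a ω m) : Measurable fun ω => trigSum s (a ω) := by
  refine measurable_of_coeff fun n => ?_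
  classical
  have h : ∀ ω, (trigSum s (a ω)).1 n =
      if HasSobolevRegularity s (fourierOfTrig (a ω)) then fourierOfTrig (a ω) n else 0 := by
    intro ω
    by_cases h : HasSobolevRegularity s (fourierOfTrig (a ω))
    · rw [coe_trigSum_of_regular h, if_pos h]
    · rw [coe_trigSum_of_not_regular h, if_neg h]
      rfl
  simp only [h]
  exact Measurable.ite (measurableSet_hasSobolevRegularity s (measurable_fourierOfTrig ha))
    (measurable_fourierOfTrig ha n) measurable_const

theorem measurable_randCoeff {Ω : Type*} [MeasurableSpace Ω] (A : Fin 2 → Mode → ℝ)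
    {ξ : Fin 2 × Mode → Ω → ℝ} (hξ : ∀ i, Measurable (ξ i)) (j : Fin 2) (m : Mode) :
    Measurable fun ω => randCoeff A ξ ω j m := (hξ (j, m)).mul_const _

theorem measurable_randData {Ω : Type*} [MeasurableSpace Ω] (s : ℝ) (A : Fin 2 → Mode → ℝ)
    {ξ : Fin 2 × Mode → Ω → ℝ} (hξ : ∀ i, Measurable (ξ i)) : Measurable (randData s A ξ) :=
  (measurable_trigSum s (measurable_randCoeff A hξ 0)).prodMk
    (measurable_trigSum (s - 1) (measurable_randCoeff A hξ 1))

theorem norm_fourierOfTrig_sq_le (A : Mode → ℝ) (k : Freq) :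
    ‖fourierOfTrig A k‖ ^ 2 ≤ ∑ r, A (slot r k) ^ 2 := by
  have h : ‖fourierOfTrig A k‖ ≤ ∑ r, 1 / 2 * |A (slot r k)| := by
    rw [fourierOfTrig_eq]
    refine (norm_sum_le _ _).trans_eq (Finset.sum_congr rfl fun r _ => ?_)
    rw [norm_mul, norm_slotWeight, Complex.norm_real, Real.norm_eq_abs]
  calc ‖fourierOfTrig A k‖ ^ 2 ≤ (∑ r, 1 / 2 * |A (slot r k)|) ^ 2 := by gcongr
    _ ≤ ((Finset.univ : Finset (Fin 4)).card : ℝ) * ∑ r, (1 / 2 * |A (slot r k)|) ^ 2 :=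
      sq_sum_le_card_mul_sum_sq
    _ = _ := by
      simp only [mul_pow, sq_abs, ← Finset.mul_sum, Finset.card_univ, Fintype.card_fin]
      push_cast
      ring

/-- The expected square of the Sobolev norm is finite by Tonelli. Uniformly bounded second moments
suffice; independence plays no role. The factor 16 is four slots times the constant of `sq_slot_le`.
-/
theorem ae_hasSobolevRegularity {Ω : Type*} [MeasurableSpace Ω] {P : Measure Ω} {s : ℝ}
    {A : Mode → ℝ} {f : Freq → ℂ} (hA : IsTrigSeriesOf A f) (hf : HasSobolevRegularity s f)
    {ξ : Mode → Ω → ℝ} (hξ : ∀ m, Measurable (ξ m)) {V : ℝ≥0∞} (hV : V ≠ ∞)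
    (hξV : ∀ m, ∫⁻ ω, ENNReal.ofReal (ξ m ω ^ 2) ∂P ≤ V) :
    ∀ᵐ ω ∂P, HasSobolevRegularity s (fourierOfTrig fun m => ξ m ω * A m) := by
  have hm : ∀ n, Measurable fun ω => fourierOfTrig (fun m => ξ m ω * A m) n :=
    measurable_fourierOfTrig fun m => (hξ m).mul_const _
  have hm' : ∀ n, Measurable fun ω =>
      ENNReal.ofReal (bracket n ^ (2 * s) * ‖fourierOfTrig (fun m => ξ m ω * A m) n‖ ^ 2) := by
    intro n
    have := hm n
    fun_prop
  have hb : ∀ n, ∫⁻ ω, ENNReal.ofReal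
      (bracket n ^ (2 * s) * ‖fourierOfTrig (fun m => ξ m ω * A m) n‖ ^ 2) ∂P ≤
      ENNReal.ofReal (bracket n ^ (2 * s) * ‖f n‖ ^ 2) * (16 * V) := by
    intro n
    have hn := bracket_pos n
    calc _ ≤ ∫⁻ ω, ∑ r : Fin 4, ENNReal.ofReal (4 * (bracket n ^ (2 * s) * ‖f n‖ ^ 2)) *
            ENNReal.ofReal (ξ (slot r n) ω ^ 2) ∂P := by
          refine lintegral_mono fun ω => ?_
          simp_rw [← ENNReal.ofReal_mul (show (0 : ℝ) ≤ 4 * (bracket n ^ (2 * s) * ‖f n‖ ^ 2) by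
            positivity)]
          rw [← ENNReal.ofReal_sum_of_nonneg fun r _ => by positivity]
          refine ENNReal.ofReal_le_ofReal ?_
          calc bracket n ^ (2 * s) * ‖fourierOfTrig (fun m => ξ m ω * A m) n‖ ^ 2
              ≤ bracket n ^ (2 * s) * ∑ r, (ξ (slot r n) ω * A (slot r n)) ^ 2 := by
                gcongr
                exact norm_fourierOfTrig_sq_le _ n
            _ ≤ _ := by
                rw [Finset.mul_sum]
                refine Finset.sum_le_sum fun r _ => ?_
                calc bracket n ^ (2 * s) * (ξ (slot r n) ω * A (slot r n)) ^ 2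
                    = bracket n ^ (2 * s) * ξ (slot r n) ω ^ 2 * A (slot r n) ^ 2 := by ring
                  _ ≤ bracket n ^ (2 * s) * ξ (slot r n) ω ^ 2 * (4 * ‖f n‖ ^ 2) := by
                    gcongr
                    exact sq_slot_le hA r n
                  _ = _ := by ring
      _ = ∑ r : Fin 4, ENNReal.ofReal (4 * (bracket n ^ (2 * s) * ‖f n‖ ^ 2)) *
            ∫⁻ ω, ENNReal.ofReal (ξ (slot r n) ω ^ 2) ∂P := by
          have hmr : ∀ r, Measurable fun ω => ENNReal.ofReal (ξ (slot r n) ω ^ 2) := fun r =>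
            ((hξ _).pow_const 2).ennreal_ofReal
          rw [lintegral_finsetSum _ fun r _ => (hmr r).const_mul _]
          simp_rw [lintegral_const_mul _ (hmr _)]
      _ ≤ ∑ _r : Fin 4, ENNReal.ofReal (4 * (bracket n ^ (2 * s) * ‖f n‖ ^ 2)) * V := by
          gcongr
          exact hξV _
      _ = _ := by
          rw [Finset.sum_const, Finset.card_univ, Fintype.card_fin, nsmul_eq_mul,
            ENNReal.ofReal_mul (by norm_num), ENNReal.ofReal_ofNat]
          push_cast
          ring
  have hfin : ∫⁻ ω, ∑' n, ENNReal.ofReal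
      (bracket n ^ (2 * s) * ‖fourierOfTrig (fun m => ξ m ω * A m) n‖ ^ 2) ∂P ≠ ∞ := by
    rw [lintegral_tsum fun n => (hm' n).aemeasurable]
    refine ne_top_of_le_ne_top ?_ (ENNReal.tsum_le_tsum hb)
    rw [ENNReal.tsum_mul_right]
    exact ENNReal.mul_ne_top ((hasSobolevRegularity_iff_tsum_ne_top s f).mp hf)
      (ENNReal.mul_ne_top (by simp) hV)
  filter_upwards [ae_lt_top (Measurable.tsum hm') hfin] with ω hω
  exact (hasSobolevRegularity_iff_tsum_ne_top s _).mpr hω.ne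

theorem lintegral_sq_le_of_hasSubgaussianMGF {Ω : Type*} [MeasurableSpace Ω] {P : Measure Ω}
    {X : Ω → ℝ} {v : ℝ≥0} (hX : HasSubgaussianMGF X v P) :
    ∫⁻ ω, ENNReal.ofReal (X ω ^ 2) ∂P ≤ ENNReal.ofReal (4 * √2 * √v) ^ (2 : ℝ) := by
  have h := eLpNorm_le_of_hasSubgaussianMGF hX one_le_two
  rw [ENNReal.ofReal_ofNat, eLpNorm_eq_lintegral_rpow_enorm_toReal (by simp) (by simp),
    ENNReal.toReal_ofNat, one_div, ENNReal.rpow_inv_le_iff zero_lt_two] at h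
  refine le_trans (lintegral_mono fun ω => ?_) h
  rw [Real.enorm_eq_ofReal_abs, ENNReal.ofReal_rpow_of_nonneg (abs_nonneg _) zero_le_two,
    Real.rpow_two, sq_abs]

/-! ### The estimate at a fixed time -/

theorem sum_le_sobolevNorm_sq {τ : ℝ} {f : Freq → ℂ} (hf : HasSobolevRegularity τ f)
    (F : Finset Freq) : ∑ n ∈ F, (bracket n ^ τ * ‖f n‖) ^ 2 ≤ sobolevNorm τ f ^ 2 := by
  have hnn : ∀ n, 0 ≤ bracket n ^ (2 * τ) * ‖f n‖ ^ 2 := fun n => by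
    have := bracket_pos n
    positivity
  rw [sobolevNorm, Real.sq_sqrt (tsum_nonneg hnn)]
  refine (Finset.sum_congr rfl fun n _ => ?_).trans_le (hf.sum_le_tsum F fun n _ => hnn n)
  rw [mul_pow, mul_comm 2 τ, Real.rpow_mul (bracket_pos n).le, Real.rpow_two]

theorem HasSobolevRegularity.mono {σ s : ℝ} (h : σ ≤ s) {f : Freq → ℂ}
    (hf : HasSobolevRegularity s f) : HasSobolevRegularity σ f := by
  refine Summable.of_nonneg_of_le (fun n => ?_) (fun n => ?_) hf
  · have := bracket_pos n
    positivity
  · have := one_le_bracket n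
    gcongr

theorem abs_slot_le {A : Mode → ℝ} {f : Freq → ℂ} (h : IsTrigSeriesOf A f) (r : Fin 4) (k : Freq) :
    |A (slot r k)| ≤ 2 * ‖f k‖ := by
  refine abs_le_of_sq_le_sq (le_of_le_of_eq (sq_slot_le h r k) ?_) (by positivity)
  ring

/-- Moments of a Fourier multiplier applied to a randomized series. -/
theorem eLpNorm_sum_mul_fourierOfTrig_le {Ω : Type*} [MeasurableSpace Ω] {P : Measure Ω}
    {ξ : Mode → Ω → ℝ} (hind : iIndepFun ξ P) {c : ℝ≥0} (hξ : ∀ i, HasSubgaussianMGF (ξ i) c P)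
    {A : Mode → ℝ} {f : Freq → ℂ} (hA : IsTrigSeriesOf A f) {τ : ℝ}
    (hf : HasSobolevRegularity τ f) {m : Freq → ℂ} {M : ℝ} (hM : 0 ≤ M)
    (hm : ∀ n, ‖m n‖ ≤ M * bracket n ^ τ) (F : Finset Freq) {p : ℝ} (hp : 1 ≤ p) :
    eLpNorm (fun ω => ∑ n ∈ F, m n * fourierOfTrig (fun k => ξ k ω * A k) n)
      (ENNReal.ofReal p) P ≤ ENNReal.ofReal (32 * √c * √p * M * sobolevNorm τ f) := by
  have hN : 0 ≤ sobolevNorm τ f := Real.sqrt_nonneg _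
  set a : Fin 4 → Freq → ℂ := fun r n => m n * slotWeight r * A (slot r n) with ha
  have hsplit : (fun ω => ∑ n ∈ F, m n * fourierOfTrig (fun k => ξ k ω * A k) n) =
      ∑ r, fun ω => ∑ n ∈ F, a r n * ξ (slot r n) ω := by
    ext ω
    rw [Finset.sum_apply, Finset.sum_comm]
    refine Finset.sum_congr rfl fun n _ => ?_
    rw [fourierOfTrig_eq, Finset.mul_sum]
    refine Finset.sum_congr rfl fun r _ => ?_
    rw [ha]
    push_cast
    ring
  have hnorm : ∀ r n, ‖a r n‖ ≤ M * (bracket n ^ τ * ‖f n‖) := by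
    intro r n
    have := bracket_pos n
    rw [ha]
    simp only [norm_mul, norm_slotWeight, Complex.norm_real, Real.norm_eq_abs]
    calc ‖m n‖ * (1 / 2) * |A (slot r n)|
        ≤ M * bracket n ^ τ * (1 / 2) * (2 * ‖f n‖) := by
          gcongr
          · exact hm n
          · exact abs_slot_le hA r n
      _ = _ := by ring
  have hsum : ∀ r, ∑ n ∈ F, ‖a r n‖ ^ 2 ≤ (M * sobolevNorm τ f) ^ 2 := by
    intro r
    calc ∑ n ∈ F, ‖a r n‖ ^ 2 ≤ ∑ n ∈ F, M ^ 2 * (bracket n ^ τ * ‖f n‖) ^ 2 := by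
          refine Finset.sum_le_sum fun n _ => ?_
          rw [← mul_pow]
          gcongr
          exact hnorm r n
      _ ≤ _ := by
          rw [← Finset.mul_sum, mul_pow]
          gcongr
          exact sum_le_sobolevNorm_sq hf F
  have hmeas : ∀ r, AEStronglyMeasurable (fun ω => ∑ n ∈ F, a r n * ξ (slot r n) ω) P := fun r =>
    Finset.aestronglyMeasurable_fun_sum _ fun n _ =>
      (Complex.continuous_ofReal.comp_aestronglyMeasurable
        (hξ (slot r n)).aestronglyMeasurable).const_mul (a r n)
  rw [hsplit]
  -- The four slots are not independent of each other, so they are joined by the triangle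
  -- inequality; `32 = 4 · 8`.
  refine (eLpNorm_sum_le (fun r _ => hmeas r) (by simpa using hp)).trans ?_
  refine (Finset.sum_le_sum fun r _ => eLpNorm_sum_mul_le hind hξ (slot_injective r) F (a r)
    (by positivity) (hsum r) hp).trans_eq ?_
  rw [Finset.sum_const, Finset.card_univ, Fintype.card_fin, nsmul_eq_mul,
    ← ENNReal.ofReal_natCast, ← ENNReal.ofReal_mul (by positivity)]
  congr 1
  push_cast
  ring

/-- The Fourier coefficients of the free evolution of the randomized series. -/
def randEvolution {Ω : Type*} (A : Fin 2 → Mode → ℝ) (ξ : Fin 2 × Mode → Ω → ℝ) (t : ℝ) (ω : Ω)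
    (n : Freq) : ℂ :=
  waveMul t n 0 * fourierOfTrig (randCoeff A ξ ω 0) n +
    waveMul t n 1 * fourierOfTrig (randCoeff A ξ ω 1) n

theorem measurable_randEvolution {Ω : Type*} [MeasurableSpace Ω] (A : Fin 2 → Mode → ℝ)
    {ξ : Fin 2 × Mode → Ω → ℝ} (hξ : ∀ i, Measurable (ξ i)) (t : ℝ) (n : Freq) :
    Measurable fun ω => randEvolution A ξ t ω n :=
  ((measurable_fourierOfTrig (measurable_randCoeff A hξ 0) n).const_mul _).add
    ((measurable_fourierOfTrig (measurable_randCoeff A hξ 1) n).const_mul _)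

/-- The trigonometric polynomials to which the embedding into `L^∞` is applied. -/
def liftedPoly {Ω : Type*} (A : Fin 2 → Mode → ℝ) (ξ : Fin 2 × Mode → Ω → ℝ) (σ t : ℝ)
    (F : Finset Freq) (ω : Ω) (x : UnitAddTorus (Fin 3)) : ℂ :=
  trigPoly F (fun n => ((smoothing σ n)⁻¹ : ℝ) * randEvolution A ξ t ω n) x

theorem norm_lift_mul_waveMul_le {σ : ℝ} (hσ : 0 < σ) (t : ℝ) (x : UnitAddTorus (Fin 3))
    (j : Fin 2) (n : Freq) :
    ‖(((smoothing σ n)⁻¹ : ℝ) : ℂ) * waveMul t n j * mFourier n x‖ ≤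
      54 * 2 ^ σ * timeBracket t * bracket n ^ (σ - j) := by
  have hb := bracket_pos n
  have ht := one_le_timeBracket t
  rw [norm_mul, norm_mul, norm_mFourier_apply, mul_one, Complex.norm_real,
    Real.norm_of_nonneg (inv_nonneg.mpr (smoothing_pos hσ n).le)]
  calc (smoothing σ n)⁻¹ * ‖waveMul t n j‖
      ≤ (27 * 2 ^ σ * bracket n ^ σ) * (2 * timeBracket t * bracket n ^ (-(j : ℝ))) := by
        gcongr
        · exact inv_smoothing_le hσ n
        · exact norm_waveMul_le t n j
    _ = _ := by
        rw [sub_eq_add_neg, Real.rpow_add hb]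
        ring

/-- A bound for the constant in the pointwise moments. -/
def momentConst (c : ℝ≥0) (σ : ℝ) : ℝ := 32 * √c * (54 * 2 ^ σ)

/-- The characters have modulus one, so they enter the multiplier freely and the bound is uniform in
`x`. Position and velocity are estimated separately; the lift and the wave multiplier together have
size `⟨n⟩^{σ-j}`, the weight of the data norm. -/
theorem eLpNorm_liftedPoly_le {Ω : Type*} [MeasurableSpace Ω] {P : Measure Ω}
    {ξ : Fin 2 × Mode → Ω → ℝ} (hm : ∀ i, Measurable (ξ i)) (hind : iIndepFun ξ P) {c : ℝ≥0}
    (hξ : ∀ i, HasSubgaussianMGF (ξ i) c P) {s σ : ℝ} (hσ : 0 < σ) (hσs : σ ≤ s) {u : Data s}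
    {A : Fin 2 → Mode → ℝ} (hA0 : IsTrigSeriesOf (A 0) u.1.1) (hA1 : IsTrigSeriesOf (A 1) u.2.1)
    (t : ℝ) (F : Finset Freq) (x : UnitAddTorus (Fin 3)) {p : ℝ} (hp : 1 ≤ p) :
    eLpNorm (fun ω => liftedPoly A ξ σ t F ω x) (ENNReal.ofReal p) P ≤
      ENNReal.ofReal (momentConst c σ * √p * dataNorm σ u * timeBracket t) := by
  have ht := one_le_timeBracket t
  have hsplit : (fun ω => liftedPoly A ξ σ t F ω x) =
      (fun ω => ∑ n ∈ F, (((smoothing σ n)⁻¹ : ℝ) : ℂ) * waveMul t n 0 * mFourier n x *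
        fourierOfTrig (fun k => ξ (0, k) ω * A 0 k) n) +
      (fun ω => ∑ n ∈ F, (((smoothing σ n)⁻¹ : ℝ) : ℂ) * waveMul t n 1 * mFourier n x *
        fourierOfTrig (fun k => ξ (1, k) ω * A 1 k) n) := by
    ext ω
    rw [Pi.add_apply, ← Finset.sum_add_distrib]
    refine Finset.sum_congr rfl fun n _ => ?_
    simp only [randEvolution]
    change _ * (_ * fourierOfTrig (fun k => ξ (0, k) ω * A 0 k) n +
      _ * fourierOfTrig (fun k => ξ (1, k) ω * A 1 k) n) * _ = _
    ring
  have hinj : ∀ j : Fin 2, Function.Injective fun k : Mode => (j, k) := fun j k l h =>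
    (Prod.mk.inj h).2
  have hw0 := fun n => norm_lift_mul_waveMul_le hσ t x 0 n
  have hw1 := fun n => norm_lift_mul_waveMul_le hσ t x 1 n
  simp only [Fin.val_zero, Nat.cast_zero, sub_zero, Fin.val_one, Nat.cast_one] at hw0 hw1
  have hb0 := eLpNorm_sum_mul_fourierOfTrig_le (hind.precomp (hinj 0)) (fun k => hξ (0, k)) hA0
    (HasSobolevRegularity.mono hσs u.1.2.2) (by positivity) hw0 F hp
  have hb1 := eLpNorm_sum_mul_fourierOfTrig_le (hind.precomp (hinj 1)) (fun k => hξ (1, k)) hA1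
    (HasSobolevRegularity.mono (sub_le_sub_right hσs 1) u.2.2.2) (by positivity) hw1 F hp
  have hmeas : ∀ j : Fin 2, AEStronglyMeasurable (fun ω => ∑ n ∈ F,
      (((smoothing σ n)⁻¹ : ℝ) : ℂ) * waveMul t n j * mFourier n x *
        fourierOfTrig (fun k => ξ (j, k) ω * A j k) n) P := fun j =>
    (Finset.measurable_fun_sum _ fun n _ => (measurable_fourierOfTrig
      (fun k => (hm (j, k)).mul_const _) n).const_mul _).aestronglyMeasurable
  rw [hsplit]
  refine (eLpNorm_add_le (hmeas 0) (hmeas 1) (by simpa using hp)).trans ?_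
  refine (add_le_add hb0 hb1).trans_eq ?_
  have hN0 : 0 ≤ sobolevNorm σ u.1.1 := Real.sqrt_nonneg _
  have hN1 : 0 ≤ sobolevNorm (σ - 1) u.2.1 := Real.sqrt_nonneg _
  rw [← ENNReal.ofReal_add (by positivity) (by positivity), momentConst, dataNorm]
  congr 1
  ring

theorem lintegral_rpow_le_of_eLpNorm_le {α E : Type*} [MeasurableSpace α] [ENorm E]
    {μ : Measure α} {f : α → E} {p : ℝ} (hp : 0 < p) {D : ℝ≥0∞}
    (h : eLpNorm f (ENNReal.ofReal p) μ ≤ D) : ∫⁻ x, ‖f x‖ₑ ^ p ∂μ ≤ D ^ p := by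
  rwa [eLpNorm_eq_lintegral_rpow_enorm_toReal (by simpa using hp) ENNReal.ofReal_ne_top,
    ENNReal.toReal_ofReal hp.le, one_div, ENNReal.rpow_inv_le_iff hp] at h

theorem eLpNorm_ofReal_rpow {α E : Type*} [MeasurableSpace α] [ENorm E]
    {μ : Measure α} {f : α → E} {p : ℝ} (hp : 0 < p) :
    eLpNorm f (ENNReal.ofReal p) μ ^ p = ∫⁻ x, ‖f x‖ₑ ^ p ∂μ := by
  rw [eLpNorm_eq_lintegral_rpow_enorm_toReal (by simpa using hp) ENNReal.ofReal_ne_top,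
    ENNReal.toReal_ofReal hp.le, one_div, ENNReal.rpow_inv_rpow hp.ne']

theorem measurable_liftedPoly {Ω : Type*} [MeasurableSpace Ω] (A : Fin 2 → Mode → ℝ)
    {ξ : Fin 2 × Mode → Ω → ℝ} (hξ : ∀ i, Measurable (ξ i)) (σ t : ℝ) (F : Finset Freq) :
    Measurable fun z : Ω × UnitAddTorus (Fin 3) => liftedPoly A ξ σ t F z.1 z.2 :=
  Finset.measurable_fun_sum _ fun n _ =>
    (((measurable_randEvolution A hξ t n).comp measurable_fst).const_mul _).mul
      ((mFourier n).continuous.measurable.comp measurable_snd)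

/-- As `q ≤ p` and `haarTorus` is a probability measure, the `L^q` norm in `x` may be raised to
`L^p`, and then Tonelli applies. -/
theorem lintegral_eLpNorm_liftedPoly_le {Ω : Type*} [MeasurableSpace Ω] {P : Measure Ω}
    [IsProbabilityMeasure P]
    {ξ : Fin 2 × Mode → Ω → ℝ} (hm : ∀ i, Measurable (ξ i)) (hind : iIndepFun ξ P) {c : ℝ≥0}
    (hξ : ∀ i, HasSubgaussianMGF (ξ i) c P) {s σ : ℝ} (hσ : 0 < σ) (hσs : σ ≤ s) {u : Data s}
    {A : Fin 2 → Mode → ℝ} (hA0 : IsTrigSeriesOf (A 0) u.1.1) (hA1 : IsTrigSeriesOf (A 1) u.2.1)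
    (t : ℝ) (F : Finset Freq) {p q : ℝ} (hp : 1 ≤ p) (hqp : q ≤ p) :
    ∫⁻ ω, eLpNorm (liftedPoly A ξ σ t F ω) (ENNReal.ofReal q) haarTorus ^ p ∂P ≤
      ENNReal.ofReal (momentConst c σ * √p * dataNorm σ u * timeBracket t) ^ p := by
  have hp0 : 0 < p := by linarith
  have hmz := measurable_liftedPoly A hm σ t F
  calc _ ≤ ∫⁻ ω, ∫⁻ x, ‖liftedPoly A ξ σ t F ω x‖ₑ ^ p ∂haarTorus ∂P := by
        refine lintegral_mono fun ω => ?_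
        rw [← eLpNorm_ofReal_rpow hp0]
        gcongr
        exact eLpNorm_le_eLpNorm_of_exponent_le (ENNReal.ofReal_le_ofReal hqp)
          (continuous_trigPoly F _).aestronglyMeasurable
    _ = ∫⁻ x, ∫⁻ ω, ‖liftedPoly A ξ σ t F ω x‖ₑ ^ p ∂P ∂haarTorus :=
        lintegral_lintegral_swap (hmz.enorm.pow_const p).aemeasurable
    _ ≤ ∫⁻ _x, ENNReal.ofReal (momentConst c σ * √p * dataNorm σ u * timeBracket t) ^ p
          ∂haarTorus := lintegral_mono fun x => lintegral_rpow_le_of_eLpNorm_le hp0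
            (eLpNorm_liftedPoly_le hm hind hξ hσ hσs hA0 hA1 t F x hp)
    _ = _ := by simp

theorem freeEvolution_randData {Ω : Type*} {s : ℝ} {A : Fin 2 → Mode → ℝ}
    {ξ : Fin 2 × Mode → Ω → ℝ} {ω : Ω}
    (h0 : HasSobolevRegularity s (fourierOfTrig (randCoeff A ξ ω 0)))
    (h1 : HasSobolevRegularity (s - 1) (fourierOfTrig (randCoeff A ξ ω 1))) (t : ℝ) :
    freeEvolution t (randData s A ξ ω) = randEvolution A ξ t ω := by
  ext n
  rw [freeEvolution_eq, randEvolution, randData, coe_trigSum_of_regular h0,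
    coe_trigSum_of_regular h1]

/-- The fixed-time estimate. The embedding acts on finite partial sums, whose moments are bounded
uniformly; lower semicontinuity in space and Fatou's lemma in `ω` remove the truncation. -/
theorem lintegral_torusLpNorm_rpow_le {Ω : Type*} [MeasurableSpace Ω] {P : Measure Ω}
    [IsProbabilityMeasure P]
    {ξ : Fin 2 × Mode → Ω → ℝ} (hm : ∀ i, Measurable (ξ i)) (hind : iIndepFun ξ P) {c : ℝ≥0}
    (hξ : ∀ i, HasSubgaussianMGF (ξ i) c P) {s σ : ℝ} (hσ : 0 < σ) (hσs : σ ≤ s) (hσ4 : σ ≤ 4)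
    {u : Data s} {A : Fin 2 → Mode → ℝ} (hA0 : IsTrigSeriesOf (A 0) u.1.1)
    (hA1 : IsTrigSeriesOf (A 1) u.2.1)
    (hreg : ∀ᵐ ω ∂P, HasSobolevRegularity s (fourierOfTrig (randCoeff A ξ ω 0)) ∧
      HasSobolevRegularity (s - 1) (fourierOfTrig (randCoeff A ξ ω 1)))
    (t : ℝ) (q : ℝ≥0∞) {p : ℝ} (hp : 4 / σ ≤ p) :
    ∫⁻ ω, torusLpNorm q (freeEvolution t (randData s A ξ ω)) ^ p ∂P ≤
      (torusMass ^ (1 / q.toReal) * embConst σ *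
        ENNReal.ofReal (momentConst c σ * √p * dataNorm σ u) *
          ENNReal.ofReal (timeBracket t)) ^ p := by
  have hp1 : 1 ≤ p := le_trans (by rwa [le_div_iff₀ hσ, one_mul]) hp
  have hp0 : 0 < p := by linarith
  have ht := one_le_timeBracket t
  obtain ⟨F, hF⟩ := exists_seq_tendsto (atTop : Filter (Finset Freq))
  set X : ℕ → Ω → ℝ≥0∞ := fun N ω =>
    eLpNorm (liftedPoly A ξ σ t (F N) ω) (ENNReal.ofReal (4 / σ)) haarTorus with hX
  have hXm : ∀ N, Measurable (X N) := by
    intro N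
    have h4 : 0 < 4 / σ := by positivity
    have : X N = fun ω =>
        (∫⁻ x, ‖liftedPoly A ξ σ t (F N) ω x‖ₑ ^ (4 / σ) ∂haarTorus) ^ (1 / (4 / σ)) := by
      ext ω
      rw [hX]
      simp only
      rw [eLpNorm_eq_lintegral_rpow_enorm_toReal (by simpa using h4) ENNReal.ofReal_ne_top,
        ENNReal.toReal_ofReal h4.le]
    rw [this]
    exact (((measurable_liftedPoly A hm σ t (F N)).enorm.pow_const _).lintegral_prod_right').pow_const
      _
  calc _ ≤ ∫⁻ ω, (torusMass ^ (1 / q.toReal)) ^ p * liminf (fun N => (embConst σ * X N ω) ^ p) atTop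
        ∂P := by
        refine lintegral_mono_ae ?_
        filter_upwards [hreg] with ω hω
        have hmem := memℓp_freeEvolution (hσ.le.trans hσs) t (randData s A ξ ω)
        rw [freeEvolution_randData hω.1 hω.2] at hmem ⊢
        have h1 : torusLpNorm ∞ (randEvolution A ξ t ω) ≤
            liminf (fun N => embConst σ * X N ω) atTop :=
          (torusLpNorm_le_liminf le_top hmem hF).trans (liminf_le_liminf
            (Eventually.of_forall fun N => eLpNorm_top_trigPoly_le hσ hσ4 (F N) _))
        have h2 : liminf (fun N => embConst σ * X N ω) atTop ^ p =
            liminf (fun N => (embConst σ * X N ω) ^ p) atTop :=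
          (ENNReal.orderIsoRpow p hp0).liminf_apply
        rw [← h2, ← ENNReal.mul_rpow_of_nonneg _ _ hp0.le]
        gcongr
        exact (torusLpNorm_le_top _).trans (by gcongr)
    _ = (torusMass ^ (1 / q.toReal)) ^ p *
          ∫⁻ ω, liminf (fun N => (embConst σ * X N ω) ^ p) atTop ∂P := by
        refine lintegral_const_mul _ (Measurable.liminf fun N => ?_)
        exact ((hXm N).const_mul _).pow_const _
    _ ≤ (torusMass ^ (1 / q.toReal)) ^ p *
          liminf (fun N => ∫⁻ ω, (embConst σ * X N ω) ^ p ∂P) atTop := by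
        gcongr
        exact lintegral_liminf_le fun N => ((hXm N).const_mul _).pow_const _
    _ ≤ (torusMass ^ (1 / q.toReal)) ^ p * (embConst σ ^ p *
          ENNReal.ofReal (momentConst c σ * √p * dataNorm σ u * timeBracket t) ^ p) := by
        gcongr
        refine (liminf_le_liminf (v := fun _ => _) (Eventually.of_forall fun N => ?_)).trans_eq
          (liminf_const _)
        simp_rw [ENNReal.mul_rpow_of_nonneg _ _ hp0.le]
        rw [lintegral_const_mul _ ((hXm N).pow_const _)]
        gcongr
        exact lintegral_eLpNorm_liftedPoly_le hm hind hξ hσ hσs hA0 hA1 t (F N) hp1 hp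
    _ = _ := by
        rw [← ENNReal.mul_rpow_of_nonneg _ _ hp0.le, ← ENNReal.mul_rpow_of_nonneg _ _ hp0.le,
          ENNReal.ofReal_mul' (by linarith)]
        simp only [mul_assoc]

/-! ### Integration in time -/

theorem measurable_eLpNorm_time {Z : Type*} [MeasurableSpace Z] {Y : ℝ → Z → ℝ≥0∞}
    (hY : Measurable (Function.uncurry Y)) {p : ℝ} (hp : 0 < p) (ν : Measure ℝ) [SFinite ν] :
    Measurable fun z => eLpNorm (fun t => Y t z) (ENNReal.ofReal p) ν := by
  simp only [eLpNorm_eq_lintegral_rpow_enorm_toReal (by simpa using hp) ENNReal.ofReal_ne_top,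
    ENNReal.toReal_ofReal hp.le, enorm_eq_self]
  exact ((hY.pow_const p).lintegral_prod_left').pow_const _

theorem measurable_uncurry_comp_right {Ω Z : Type*} [MeasurableSpace Ω] [MeasurableSpace Z]
    {Y : ℝ → Z → ℝ≥0∞} (hY : Measurable (Function.uncurry Y)) {X : Ω → Z} (hX : Measurable X) :
    Measurable (Function.uncurry fun t ω => Y t (X ω)) :=
  hY.comp (measurable_fst.prodMk (hX.comp measurable_snd))

/-- Moments of a mixed norm, from moments at fixed times. -/
theorem lintegral_eLpNorm_rpow_le {Ω : Type*} [MeasurableSpace Ω] {P : Measure Ω} [SFinite P]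
    {ν : Measure ℝ} [SFinite ν] {Y : ℝ → Ω → ℝ≥0∞} (hY : Measurable (Function.uncurry Y))
    {k : ℝ → ℝ≥0∞} (hk : Measurable k) (hk0 : ∀ t, k t ≠ 0) (hkt : ∀ t, k t ≠ ∞)
    {p₁ p : ℝ} (hp₁ : 0 < p₁) (hp : p₁ ≤ p) {D : ℝ≥0∞}
    (hYD : ∀ t, ∫⁻ ω, Y t ω ^ p ∂P ≤ (D * k t) ^ p) :
    ∫⁻ ω, eLpNorm (fun t => Y t ω) (ENNReal.ofReal p₁) ν ^ p ∂P ≤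
      (D * (∫⁻ t, k t ^ p₁ ∂ν) ^ (1 / p₁)) ^ p := by
  have hp0 : 0 < p := hp₁.trans_le hp
  -- Moving `k` into the measure and dividing `Y` by it makes the moments uniform in `t`, so that
  -- Hölder for the total mass `M` of `κ` and Tonelli replace Minkowski's inequality.
  set κ : Measure ℝ := ν.withDensity fun t => k t ^ p₁ with hκ
  set M : ℝ≥0∞ := ∫⁻ t, k t ^ p₁ ∂ν with hM
  have hκu : κ Set.univ = M := by
    rw [hκ, withDensity_apply _ MeasurableSet.univ, Measure.restrict_univ]
  set G : ℝ → Ω → ℝ≥0∞ := fun t ω => Y t ω * (k t)⁻¹ with hG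
  have hGm : Measurable (Function.uncurry G) := hY.mul (hk.inv.comp measurable_fst)
  have hGt : ∀ ω, Measurable fun t => G t ω := fun ω => hGm.comp measurable_prodMk_right
  have h1 : ∀ ω, eLpNorm (fun t => Y t ω) (ENNReal.ofReal p₁) ν =
      eLpNorm (fun t => G t ω) (ENNReal.ofReal p₁) κ := by
    intro ω
    simp only [eLpNorm_eq_lintegral_rpow_enorm_toReal
      (show ENNReal.ofReal p₁ ≠ 0 by simpa using hp₁) ENNReal.ofReal_ne_top,
      ENNReal.toReal_ofReal hp₁.le, enorm_eq_self]
    congr 1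
    rw [hκ, lintegral_withDensity_eq_lintegral_mul _ (hk.pow_const p₁) ((hGt ω).pow_const p₁)]
    refine lintegral_congr fun t => ?_
    rw [Pi.mul_apply, ← ENNReal.mul_rpow_of_nonneg _ _ hp₁.le, hG]
    simp only
    rw [mul_comm (Y t ω), ← mul_assoc, ENNReal.mul_inv_cancel (hk0 t) (hkt t), one_mul]
  have h2 : ∀ ω, eLpNorm (fun t => Y t ω) (ENNReal.ofReal p₁) ν ^ p ≤
      (∫⁻ t, G t ω ^ p ∂κ) * M ^ (p / p₁ - 1) := by
    intro ω
    rw [h1 ω]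
    have h := eLpNorm_le_eLpNorm_mul_rpow_measure_univ (μ := κ) (ENNReal.ofReal_le_ofReal hp)
      (hGt ω).aestronglyMeasurable
    rw [hκu, ENNReal.toReal_ofReal hp₁.le, ENNReal.toReal_ofReal hp0.le] at h
    refine (ENNReal.rpow_le_rpow h hp0.le).trans_eq ?_
    rw [ENNReal.mul_rpow_of_nonneg _ _ hp0.le, eLpNorm_ofReal_rpow hp0, ← ENNReal.rpow_mul]
    congr 2
    field_simp
  have h3 : ∀ t, ∫⁻ ω, G t ω ^ p ∂P ≤ D ^ p := by
    intro t
    simp only [hG, ENNReal.mul_rpow_of_nonneg _ _ hp0.le]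
    rw [lintegral_mul_const' _ _ (ENNReal.rpow_ne_top_of_nonneg hp0.le
      (ENNReal.inv_ne_top.mpr (hk0 t)))]
    refine (mul_le_mul_left (hYD t) _).trans_eq ?_
    rw [← ENNReal.mul_rpow_of_nonneg _ _ hp0.le, mul_assoc,
      ENNReal.mul_inv_cancel (hk0 t) (hkt t), mul_one]
  have hexp : 0 ≤ p / p₁ - 1 := by rw [sub_nonneg, le_div_iff₀ hp₁, one_mul]; exact hp
  calc _ ≤ ∫⁻ ω, (∫⁻ t, G t ω ^ p ∂κ) * M ^ (p / p₁ - 1) ∂P := lintegral_mono h2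
    _ = (∫⁻ ω, ∫⁻ t, G t ω ^ p ∂κ ∂P) * M ^ (p / p₁ - 1) :=
        lintegral_mul_const _ (hGm.pow_const p).lintegral_prod_left'
    _ = (∫⁻ t, ∫⁻ ω, G t ω ^ p ∂P ∂κ) * M ^ (p / p₁ - 1) := by
        rw [lintegral_lintegral_swap]
        exact ((hGm.comp measurable_swap).pow_const p).aemeasurable
    _ ≤ (∫⁻ _t, D ^ p ∂κ) * M ^ (p / p₁ - 1) := by
        gcongr
        exact h3 _
    _ = D ^ p * (M ^ (1 : ℝ) * M ^ (p / p₁ - 1)) := by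
        rw [lintegral_const, hκu, ENNReal.rpow_one, mul_assoc]
    _ = _ := by
        rw [← ENNReal.rpow_add_of_nonneg _ _ zero_le_one hexp, ENNReal.mul_rpow_of_nonneg _ _ hp0.le,
          ← ENNReal.rpow_mul]
        congr 2
        ring

theorem measurable_timeBracket : Measurable timeBracket := by
  unfold timeBracket
  fun_prop

/-- The condition on `δ` says exactly that the decay exponent `(δ-1)p₁` exceeds the dimension 1 of
time. -/
theorem lintegral_timeBracket_ne_top {p₁ δ : ℝ} (hp₁ : 0 < p₁) (hδ : 1 + 1 / p₁ < δ) :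
    ∫⁻ t, ENNReal.ofReal (timeBracket t ^ (1 - δ)) ^ p₁ ≠ ∞ := by
  have hr : 1 < (δ - 1) * p₁ := by
    have : 1 / p₁ < δ - 1 := by linarith
    rwa [div_lt_iff₀ hp₁] at this
  have h := integrable_rpow_neg_one_add_norm_sq (E := ℝ) (μ := volume) (r := (δ - 1) * p₁)
    (by simpa using hr)
  refine ne_of_lt (lt_of_eq_of_lt (lintegral_congr fun t => ?_) h.lintegral_lt_top)
  have ht := one_le_timeBracket t
  have hpos : (0 : ℝ) ≤ 1 + t ^ 2 := by positivity
  rw [ENNReal.ofReal_rpow_of_nonneg (by positivity) hp₁.le, timeBracket, Real.sqrt_eq_rpow,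
    ← Real.rpow_mul hpos, ← Real.rpow_mul hpos, Real.norm_eq_abs, sq_abs]
  congr 2
  ring

theorem weightedNorm_eq {s : ℝ} (δ : ℝ) (p q : ℝ≥0∞) (v : Data s) :
    weightedNorm δ p q v = eLpNorm (fun t => ENNReal.ofReal (timeBracket t ^ (-δ)) *
      torusLpNorm q (freeEvolution t v)) p volume := by
  rw [weightedNorm, mixedNorm]
  congr 1
  ext t
  have ht : 0 < timeBracket t ^ (-δ) :=
    Real.rpow_pos_of_pos (zero_lt_one.trans_le (one_le_timeBracket t)) _
  rw [torusLpNorm_const_mul q (by exact_mod_cast ht.ne'), ← ofReal_norm, Complex.norm_real,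
    Real.norm_of_nonneg ht.le]

theorem measurable_weighted {s : ℝ} (hs : 0 ≤ s) (δ : ℝ) {q : ℝ≥0∞} (hq : 2 ≤ q) :
    Measurable (Function.uncurry fun (t : ℝ) (v : Data s) =>
      ENNReal.ofReal (timeBracket t ^ (-δ)) * torusLpNorm q (freeEvolution t v)) :=
  (((measurable_timeBracket.pow_const _).ennreal_ofReal).comp measurable_fst).mul
    (measurable_torusLpNorm_freeEvolution hs hq)

theorem measurable_weightedNorm {s : ℝ} (hs : 0 ≤ s) (δ : ℝ) {p : ℝ} (hp : 0 < p) {q : ℝ≥0∞}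
    (hq : 2 ≤ q) : Measurable fun v : Data s => weightedNorm δ (ENNReal.ofReal p) q v := by
  simp only [weightedNorm_eq]
  exact measurable_eLpNorm_time (measurable_weighted hs δ hq) hp volume

/-- Moments of size `√p` imply a Gaussian tail. -/
theorem measure_lt_le_of_moments {α : Type*} [MeasurableSpace α] {μ : Measure α}
    [IsProbabilityMeasure μ] {W : α → ℝ≥0∞} (hW : Measurable W) {C N : ℝ} (hC : 0 < C)
    (hN : 0 < N)
    (h : ∀ p : ℝ, 2 ≤ p → eLpNorm W (ENNReal.ofReal p) μ ≤ ENNReal.ofReal (C * √p * N)) {l : ℝ}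
    (hl : 0 < l) :
    μ {v | ENNReal.ofReal l < W v} ≤
      ENNReal.ofReal (Real.exp 2 * Real.exp (-((Real.exp 1 * C) ^ 2)⁻¹ * l ^ 2 / N ^ 2)) := by
  -- Chosen so that `C √p N = l/e`; Markov's inequality for the `p`-th moment then gives `e^{-p}`.
  set p : ℝ := (l / (Real.exp 1 * C * N)) ^ 2 with hp
  have hexp : -((Real.exp 1 * C) ^ 2)⁻¹ * l ^ 2 / N ^ 2 = -p := by
    rw [hp]
    field_simp
  rw [hexp, ← Real.exp_add]
  -- For `p < 2` no moment bound is available, but the prefactor `e²` makes the right-hand side at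
  -- least 1.
  rcases lt_or_ge p 2 with hp2 | hp2
  · refine prob_le_one.trans ?_
    rw [← ENNReal.ofReal_one]
    exact ENNReal.ofReal_le_ofReal (Real.one_le_exp (by linarith))
  have hp0 : 0 < p := by linarith
  have hsqrt : √p = l / (Real.exp 1 * C * N) := Real.sqrt_sq (by positivity)
  have h1 := lintegral_rpow_le_of_eLpNorm_le hp0 (h p hp2)
  have hval : C * √p * N = l * Real.exp (-1) := by
    rw [hsqrt, Real.exp_neg]
    field_simp
  rw [hval, ENNReal.ofReal_mul hl.le, ENNReal.mul_rpow_of_nonneg _ _ hp0.le] at h1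
  simp only [enorm_eq_self] at h1
  have h2 := mul_meas_ge_le_lintegral (μ := μ) (hW.pow_const p) (ENNReal.ofReal l ^ p)
  have hsub : {v | ENNReal.ofReal l < W v} ⊆ {v | ENNReal.ofReal l ^ p ≤ W v ^ p} := fun v hv =>
    ENNReal.rpow_le_rpow (le_of_lt hv) hp0.le
  have hl0 : ENNReal.ofReal l ^ p ≠ 0 := by
    simp [ENNReal.rpow_eq_zero_iff, hl]
  have hlt : ENNReal.ofReal l ^ p ≠ ∞ :=
    ENNReal.rpow_ne_top_of_nonneg hp0.le ENNReal.ofReal_ne_top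
  have h3 := (ENNReal.mul_le_mul_iff_right hl0 hlt).mp (h2.trans h1)
  refine ((measure_mono hsub).trans h3).trans ?_
  rw [ENNReal.ofReal_rpow_of_nonneg (Real.exp_pos _).le hp0.le, ← Real.exp_mul]
  exact ENNReal.ofReal_le_ofReal (Real.exp_le_exp.mpr (by linarith))

theorem lintegral_Icc_timeBracket_ne_top {R : ℝ} (hR : 0 ≤ R) (T : ℝ) :
    ∫⁻ t in Set.Icc 0 T, ENNReal.ofReal (timeBracket t) ^ R ≠ ∞ := by
  have htb : ∀ t, 0 < timeBracket t := fun t => zero_lt_one.trans_le (one_le_timeBracket t)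
  have hc : Continuous fun t => timeBracket t ^ R := by
    have : Continuous timeBracket := by unfold timeBracket; fun_prop
    exact this.rpow_const fun t => Or.inl (htb t).ne'
  have hi := (hc.continuousOn (s := Set.Icc 0 T)).integrableOn_Icc (μ := volume)
  refine ne_of_lt (lt_of_eq_of_lt (lintegral_congr fun t => ?_) hi.lintegral_lt_top)
  rw [ENNReal.ofReal_rpow_of_nonneg (htb t).le hR]

/-- Almost sure finiteness on bounded time intervals, from moments at fixed times. -/
theorem ae_eLpNorm_Icc_lt_top {Ω : Type*} [MeasurableSpace Ω] {P : Measure Ω} [SFinite P]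
    {Y : ℝ → Ω → ℝ≥0∞} (hY : Measurable (Function.uncurry Y)) {R : ℝ} {D : ℝ≥0∞} (hD : D ≠ ∞)
    (hYD : ∀ t, ∫⁻ ω, Y t ω ^ R ∂P ≤ (D * ENNReal.ofReal (timeBracket t)) ^ R)
    {r₁ : ℝ} (hr₁ : 1 ≤ r₁) (hR : r₁ ≤ R) (T : ℝ) :
    ∀ᵐ ω ∂P, eLpNorm (fun t => Y t ω) (ENNReal.ofReal r₁) (volume.restrict (Set.Icc 0 T)) < ∞ := by
  have hr0 : 0 < r₁ := by linarith
  have hR0 : 0 < R := by linarith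
  -- The same exponent `R` is used in time and in probability; Hölder on the bounded interval then
  -- descends to `r₁`.
  have hb := lintegral_eLpNorm_rpow_le (ν := volume.restrict (Set.Icc 0 T)) hY
    (k := fun t => ENNReal.ofReal (timeBracket t)) measurable_timeBracket.ennreal_ofReal
    (fun t => by simpa using zero_lt_one.trans_le (one_le_timeBracket t))
    (fun t => ENNReal.ofReal_ne_top) hR0 le_rfl hYD
  have hfin : ∫⁻ ω, eLpNorm (fun t => Y t ω) (ENNReal.ofReal R)
      (volume.restrict (Set.Icc 0 T)) ^ R ∂P ≠ ∞ :=
    ne_top_of_le_ne_top (ENNReal.rpow_ne_top_of_nonneg hR0.le (ENNReal.mul_ne_top hD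
      (ENNReal.rpow_ne_top_of_nonneg (by positivity)
        (lintegral_Icc_timeBracket_ne_top hR0.le T)))) hb
  filter_upwards [ae_lt_top ((measurable_eLpNorm_time hY hR0 _).pow_const R) hfin] with ω hω
  have hω' := (ENNReal.rpow_lt_top_iff_of_pos hR0).mp hω
  have hmt : Measurable fun t => Y t ω := hY.comp measurable_prodMk_right
  refine lt_of_le_of_lt (eLpNorm_le_eLpNorm_mul_rpow_measure_univ (ENNReal.ofReal_le_ofReal hR)
    hmt.aestronglyMeasurable) (ENNReal.mul_lt_top hω' ?_)
  rw [ENNReal.toReal_ofReal hr0.le, ENNReal.toReal_ofReal hR0.le]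
  refine (ENNReal.rpow_ne_top_of_nonneg ?_ (measure_ne_top _ _)).lt_top
  rw [sub_nonneg]
  exact one_div_le_one_div_of_le hr0 hR

theorem ae_mixedNorm_lt_top {Ω : Type*} [MeasurableSpace Ω] {P : Measure Ω} [SFinite P]
    {s : ℝ} (hs : 0 ≤ s) {X : Ω → Data s} (hX : Measurable X)
    {r₂ : ℝ≥0∞} (hr₂ : 2 ≤ r₂) {R : ℝ} {D : ℝ≥0∞} (hD : D ≠ ∞)
    (hXD : ∀ t, ∫⁻ ω, torusLpNorm r₂ (freeEvolution t (X ω)) ^ R ∂P ≤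
      (D * ENNReal.ofReal (timeBracket t)) ^ R) {r₁ : ℝ} (hr₁ : 1 ≤ r₁) (hR : r₁ ≤ R) (T : ℝ) :
    ∀ᵐ v ∂(P.map X), mixedNorm (volume.restrict (Set.Icc 0 T)) (ENNReal.ofReal r₁) r₂
      (fun t => freeEvolution t v) < ∞ := by
  have hm := measurable_torusLpNorm_freeEvolution (s := s) hs hr₂
  have hmeas : Measurable fun v : Data s =>
      mixedNorm (volume.restrict (Set.Icc 0 T)) (ENNReal.ofReal r₁) r₂
        (fun t => freeEvolution t v) := by
    unfold mixedNorm
    exact measurable_eLpNorm_time (Y := fun t (v : Data s) => torusLpNorm r₂ (freeEvolution t v))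
      hm (by linarith) _
  have hset : MeasurableSet {v : Data s | mixedNorm (volume.restrict (Set.Icc 0 T))
      (ENNReal.ofReal r₁) r₂ (fun t => freeEvolution t v) < ∞} :=
    measurableSet_lt hmeas measurable_const
  rw [ae_map_iff hX.aemeasurable hset]
  have hY : Measurable (Function.uncurry fun t ω => torusLpNorm r₂ (freeEvolution t (X ω))) :=
    measurable_uncurry_comp_right (Y := fun t v => torusLpNorm r₂ (freeEvolution t v)) hm hX
  have h := ae_eLpNorm_Icc_lt_top hY hD hXD hr₁ hR T
  filter_upwards [h] with ω hω
  rw [mixedNorm]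
  exact hω

/-- The time factor of the constant in the moment bound. -/
def timeConst (p₁ δ : ℝ) : ℝ≥0∞ :=
  (∫⁻ t, ENNReal.ofReal (timeBracket t ^ (1 - δ)) ^ p₁) ^ (1 / p₁)

/-- The constant of the moment bound. -/
def strichartzConst (σ p₁ : ℝ) (p₂ : ℝ≥0∞) (δ c₀ : ℝ) : ℝ :=
  (torusMass ^ (1 / p₂.toReal) * embConst σ * timeConst p₁ δ).toReal *
    (momentConst (2 * c₀).toNNReal σ * √(max p₁ (4 / σ))) + 1

theorem momentConst_nonneg (c : ℝ≥0) (σ : ℝ) : 0 ≤ momentConst c σ := by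
  unfold momentConst; positivity

theorem dataNorm_nonneg (σ : ℝ) {s : ℝ} (u : Data s) : 0 ≤ dataNorm σ u :=
  add_nonneg (Real.sqrt_nonneg _) (Real.sqrt_nonneg _)

theorem strichartzConst_pos (σ p₁ : ℝ) (p₂ : ℝ≥0∞) (δ c₀ : ℝ) :
    0 < strichartzConst σ p₁ p₂ δ c₀ := by
  have := momentConst_nonneg (2 * c₀).toNNReal σ
  unfold strichartzConst
  positivity

/-- The moment bound for the randomized free evolution. -/
theorem eLpNorm_weightedNorm_le {Ω : Type*} [MeasurableSpace Ω] {P : Measure Ω}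
    [IsProbabilityMeasure P] {s σ : ℝ} (hs : 0 ≤ s) (hσ : 0 < σ) {p₁ : ℝ} (hp₁ : 1 ≤ p₁)
    {p₂ : ℝ≥0∞} (hp₂ : 2 ≤ p₂) {δ : ℝ} (hδ : 1 + 1 / p₁ < δ) {c₀ : ℝ} {u : Data s}
    {X : Ω → Data s} (hX : Measurable X)
    (hXu : ∀ (t p : ℝ), 4 / σ ≤ p → ∫⁻ ω, torusLpNorm p₂ (freeEvolution t (X ω)) ^ p ∂P ≤
      (torusMass ^ (1 / p₂.toReal) * embConst σ *
        ENNReal.ofReal (momentConst (2 * c₀).toNNReal σ * √p * dataNorm σ u) *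
          ENNReal.ofReal (timeBracket t)) ^ p) {p : ℝ} (hp : 1 ≤ p) :
    eLpNorm (fun v : Data s => weightedNorm δ (ENNReal.ofReal p₁) p₂ v) (ENNReal.ofReal p)
      (P.map X) ≤ ENNReal.ofReal (strichartzConst σ p₁ p₂ δ c₀ * √p * dataNorm σ u) := by
  have hp₁0 : 0 < p₁ := by linarith
  have hN := dataNorm_nonneg σ u
  have hc := momentConst_nonneg (2 * c₀).toNNReal σ
  -- The exponent `p` may lie below `p₁` or `4/σ`, but `pQ` does not. Passing from `p` to `pQ` on a
  -- probability space costs only the factor `√Q`, and the growth `√p` is kept.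
  set Q : ℝ := max p₁ (4 / σ) with hQ
  have hQ1 : 1 ≤ Q := hp₁.trans (le_max_left _ _)
  set p' : ℝ := p * Q with hp'
  have hpp' : p ≤ p' := le_mul_of_one_le_right (by linarith) hQ1
  have hQp' : Q ≤ p' := le_mul_of_one_le_left (by linarith) hp
  have hp'0 : 0 < p' := by linarith
  have htb : ∀ t, 0 < timeBracket t := fun t => zero_lt_one.trans_le (one_le_timeBracket t)
  have hWm := measurable_weightedNorm hs δ hp₁0 hp₂
  set K : ℝ≥0∞ := torusMass ^ (1 / p₂.toReal) * embConst σ with hK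
  set m : ℝ := momentConst (2 * c₀).toNNReal σ * √p' * dataNorm σ u with hm
  have hfix : ∀ t, ∫⁻ ω, (ENNReal.ofReal (timeBracket t ^ (-δ)) *
      torusLpNorm p₂ (freeEvolution t (X ω))) ^ p' ∂P ≤
      (K * ENNReal.ofReal m * ENNReal.ofReal (timeBracket t ^ (1 - δ))) ^ p' := by
    intro t
    simp only [ENNReal.mul_rpow_of_nonneg _ _ hp'0.le]
    rw [lintegral_const_mul' _ _
      (ENNReal.rpow_ne_top_of_nonneg hp'0.le ENNReal.ofReal_ne_top)]
    refine (mul_le_mul_right (hXu t p' ((le_max_right _ _).trans hQp')) _).trans_eq ?_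
    simp only [← ENNReal.mul_rpow_of_nonneg _ _ hp'0.le]
    congr 1
    rw [sub_eq_neg_add, Real.rpow_add (htb t), Real.rpow_one,
      ENNReal.ofReal_mul (Real.rpow_nonneg (htb t).le _)]
    ring
  have hYm : Measurable (Function.uncurry fun t ω => ENNReal.ofReal (timeBracket t ^ (-δ)) *
      torusLpNorm p₂ (freeEvolution t (X ω))) :=
    measurable_uncurry_comp_right (measurable_weighted hs δ hp₂) hX
  have hint := lintegral_eLpNorm_rpow_le (ν := volume) hYm
    (k := fun t => ENNReal.ofReal (timeBracket t ^ (1 - δ)))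
    (measurable_timeBracket.pow_const _).ennreal_ofReal
    (fun t => by simpa using Real.rpow_pos_of_pos (htb t) _) (fun t => ENNReal.ofReal_ne_top)
    hp₁0 ((le_max_left _ _).trans hQp') hfix
  have hbound : eLpNorm (fun ω => weightedNorm δ (ENNReal.ofReal p₁) p₂ (X ω))
      (ENNReal.ofReal p') P ≤ K * ENNReal.ofReal m * timeConst p₁ δ := by
    rw [eLpNorm_eq_lintegral_rpow_enorm_toReal (by simpa using hp'0) ENNReal.ofReal_ne_top,
      ENNReal.toReal_ofReal hp'0.le, one_div, ENNReal.rpow_inv_le_iff hp'0]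
    simpa only [enorm_eq_self, weightedNorm_eq, timeConst] using hint
  have hKt : K * timeConst p₁ δ ≠ ∞ := by
    refine ENNReal.mul_ne_top (ENNReal.mul_ne_top
      (ENNReal.rpow_ne_top_of_nonneg (by positivity) torusMass_ne_top) (embConst_ne_top hσ)) ?_
    exact ENNReal.rpow_ne_top_of_nonneg (by positivity) (lintegral_timeBracket_ne_top hp₁0 hδ)
  rw [eLpNorm_map_measure hWm.aestronglyMeasurable hX.aemeasurable]
  calc _ ≤ eLpNorm (fun ω => weightedNorm δ (ENNReal.ofReal p₁) p₂ (X ω)) (ENNReal.ofReal p') P :=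
        eLpNorm_le_eLpNorm_of_exponent_le (ENNReal.ofReal_le_ofReal hpp')
          (hWm.comp hX).aestronglyMeasurable
    _ ≤ K * ENNReal.ofReal m * timeConst p₁ δ := hbound
    _ = ENNReal.ofReal ((K * timeConst p₁ δ).toReal * m) := by
        rw [ENNReal.ofReal_mul ENNReal.toReal_nonneg, ENNReal.ofReal_toReal hKt]
        ring
    _ ≤ _ := by
        refine ENNReal.ofReal_le_ofReal ?_
        have h0 : 0 ≤ √p * dataNorm σ u := by positivity
        rw [hm, hp', Real.sqrt_mul (by linarith), strichartzConst]
        -- The summand 1 in `strichartzConst`, which keeps the constant positive, contributes this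
        -- nonnegative excess.
        linear_combination h0

end ProbStrichartz

end

open ProbStrichartz in
theorem theorem2 {s : ℝ} (hs0 : 0 < s) (hs1 : s < 1) {σ : ℝ} (hσ0 : 0 < σ) (hσs : σ ≤ s)
    {p₁ : ℝ} (hp₁ : 2 ≤ p₁) {p₂ : ℝ≥0∞} (hp₂ : 2 ≤ p₂) {δ : ℝ} (hδ : 1 + 1 / p₁ < δ)
    {c₀ : ℝ} (hc₀ : 0 < c₀) :
    ∃ C > (0 : ℝ), ∃ C' > (0 : ℝ), ∃ c' > (0 : ℝ),
      ∀ {Ω : Type*} [MeasurableSpace Ω] (P : Measure Ω) [IsProbabilityMeasure P]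
        (θ : Measure ℝ) (_ : SubGaussianLaw c₀ θ)
        (ξ : Fin 2 × Mode → Ω → ℝ) (_ : ∀ i, Measurable (ξ i)) (_ : ∀ i, P.map (ξ i) = θ)
        (_ : iIndepFun ξ P)
        (u : Data s) (A : Fin 2 → Mode → ℝ) (_ : IsTrigSeriesOf (A 0) u.1.1)
        (_ : IsTrigSeriesOf (A 1) u.2.1),
        -- the randomized series lie almost surely in the Sobolev spaces, the randomization is
        -- measurable, and so is the spatial norm of the free evolution
        (∀ᵐ ω ∂P, HasSobolevRegularity s (fourierOfTrig (randCoeff A ξ ω 0)) ∧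
          HasSobolevRegularity (s - 1) (fourierOfTrig (randCoeff A ξ ω 1))) ∧
        AEMeasurable (randData s A ξ) P ∧
        (∀ q : ℝ≥0∞, 2 ≤ q →
          Measurable fun z : ℝ × Data s => torusLpNorm q (freeEvolution z.1 z.2)) ∧
        -- the moment bound
        (∀ p : ℝ, 2 ≤ p →
          eLpNorm (fun v : Data s => weightedNorm δ (ENNReal.ofReal p₁) p₂ v) (ENNReal.ofReal p)
              (inducedMeasure P s A ξ) ≤
            ENNReal.ofReal (C * √p * dataNorm σ u)) ∧
        -- almost sure finiteness
        (∀ T : ℝ, 0 < T → ∀ r₁ : ℝ, 1 ≤ r₁ → ∀ r₂ : ℝ≥0∞, 2 ≤ r₂ →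
          ∀ᵐ v ∂(inducedMeasure P s A ξ),
            mixedNorm (volume.restrict (Set.Icc 0 T)) (ENNReal.ofReal r₁) r₂
              (fun t => freeEvolution t v) < ∞) ∧
        -- the tail bound, whose right-hand side is `0` if the initial data vanish
        (∀ l : ℝ, 0 < l →
          inducedMeasure P s A ξ
              {v : Data s | ENNReal.ofReal l < weightedNorm δ (ENNReal.ofReal p₁) p₂ v} ≤
            if dataNorm σ u = 0 then 0
            else ENNReal.ofReal (C' * Real.exp (-(c' * l ^ 2) / dataNorm σ u ^ 2))) := by
  have hCpos := strichartzConst_pos σ p₁ p₂ δ c₀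
  refine ⟨strichartzConst σ p₁ p₂ δ c₀, hCpos, Real.exp 2, Real.exp_pos 2,
    ((Real.exp 1 * strichartzConst σ p₁ p₂ δ c₀) ^ 2)⁻¹, by positivity, ?_⟩
  intro Ω _ P _ θ hθ ξ hm hlaw hind u A hA0 hA1
  have hp₁0 : 0 < p₁ := by linarith
  have hξ : ∀ i, HasSubgaussianMGF (ξ i) (2 * c₀).toNNReal P := fun i =>
    hθ.hasSubgaussianMGF hc₀.le (hm i) (hlaw i)
  have hV : ENNReal.ofReal (4 * √2 * √(2 * c₀).toNNReal) ^ (2 : ℝ) ≠ ∞ :=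
    ENNReal.rpow_ne_top_of_nonneg zero_le_two ENNReal.ofReal_ne_top
  have hreg : ∀ᵐ ω ∂P, HasSobolevRegularity s (fourierOfTrig (randCoeff A ξ ω 0)) ∧
      HasSobolevRegularity (s - 1) (fourierOfTrig (randCoeff A ξ ω 1)) :=
    (ae_hasSobolevRegularity hA0 u.1.2.2 (fun m => hm (0, m)) hV
      fun m => lintegral_sq_le_of_hasSubgaussianMGF (hξ (0, m))).and
    (ae_hasSobolevRegularity hA1 u.2.2.2 (fun m => hm (1, m)) hV
      fun m => lintegral_sq_le_of_hasSubgaussianMGF (hξ (1, m)))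
  have hX : Measurable (randData s A ξ) := measurable_randData s A hm
  have hfix : ∀ (q : ℝ≥0∞) (t p : ℝ), 4 / σ ≤ p →
      ∫⁻ ω, torusLpNorm q (freeEvolution t (randData s A ξ ω)) ^ p ∂P ≤
        (torusMass ^ (1 / q.toReal) * embConst σ *
          ENNReal.ofReal (momentConst (2 * c₀).toNNReal σ * √p * dataNorm σ u) *
            ENNReal.ofReal (timeBracket t)) ^ p := fun q t p hp =>
    lintegral_torusLpNorm_rpow_le hm hind hξ hσ0 hσs (by linarith) hA0 hA1 hreg t q hp
  have hmom : ∀ p : ℝ, 2 ≤ p →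
      eLpNorm (fun v : Data s => weightedNorm δ (ENNReal.ofReal p₁) p₂ v) (ENNReal.ofReal p)
        (inducedMeasure P s A ξ) ≤
          ENNReal.ofReal (strichartzConst σ p₁ p₂ δ c₀ * √p * dataNorm σ u) := fun p hp =>
    eLpNorm_weightedNorm_le hs0.le hσ0 (by linarith) hp₂ hδ hX (hfix p₂) (by linarith)
  have hWm : Measurable fun v : Data s => weightedNorm δ (ENNReal.ofReal p₁) p₂ v :=
    measurable_weightedNorm hs0.le δ hp₁0 hp₂
  refine ⟨hreg, hX.aemeasurable, fun q hq => measurable_torusLpNorm_freeEvolution hs0.le hq, hmom,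
    fun T _ r₁ hr₁ r₂ hr₂ => ?_, fun l hl => ?_⟩
  -- The exponent `R` is `max r₁ (4/σ)`, so the fixed-time estimate applies.
  · refine ae_mixedNorm_lt_top hs0.le hX hr₂ ?_ (fun t => hfix r₂ t _ (le_max_right r₁ _)) hr₁
      (le_max_left _ _) T
    exact ENNReal.mul_ne_top (ENNReal.mul_ne_top
      (ENNReal.rpow_ne_top_of_nonneg (by positivity) torusMass_ne_top) (embConst_ne_top hσ0))
      ENNReal.ofReal_ne_top
  · have : IsProbabilityMeasure (inducedMeasure P s A ξ) :=
      Measure.isProbabilityMeasure_map hX.aemeasurable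
    split_ifs with hN
    -- For vanishing data the second moment is zero, so the norm vanishes almost surely.
    · have h := hmom 2 le_rfl
      rw [hN, mul_zero, ENNReal.ofReal_zero, nonpos_iff_eq_zero,
        eLpNorm_eq_zero_iff hWm.aestronglyMeasurable (by simp)] at h
      refine le_of_eq (measure_mono_null (fun v hv => ?_) h)
      exact (lt_of_le_of_lt zero_le hv).ne'
    · have h := measure_lt_le_of_moments hWm hCpos
        (lt_of_le_of_ne (dataNorm_nonneg σ u) (Ne.symm hN)) hmom hl
      rwa [neg_mul] at h
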